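/- Let $\mathbb{H}=\{x+iy : y>0\}$ be the hyperbolic plane with metric $ds=\sqrt{dx^2+dy^2}/y$ and area form $dx\,dy/y^2$. Let $D\subset\mathbb{H}$ be a compact geodesically convex set with non-empty interior whose boundary $\partial D$ is $C^1$, that is, a regular simple closed $C^1$ curve. Let $L(\partial D)$ denote the hyperbolic length of $\partial D$ and $A(D)$ the hyperbolic area of $D$. Then $$L(\partial D)^2\ \ge\ 4\pi A(D)+A(D)^2,$$ and equality holds if and only if $D$ is a hyperbolic disk, that is, a closed ball of positive radius for the hyperbolic distance. -/

import Mathlib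

open MeasureTheory Set
open scoped UpperHalfPlane

namespace HypIso

/-- The closed geodesic segment between two points of the hyperbolic plane. Geodesics of `ℍ` are
unique and minimizing, so it consists of the points at which the triangle inequality for the
hyperbolic distance is an equality. -/
def geodesicSegment (z w : ℍ) : Set ℍ :=
  {p | dist z p + dist p w = dist z w}

/-- A set in the hyperbolic plane is convex if it contains the geodesic segment between any two
of its points. -/
def IsConvex (D : Set ℍ) : Prop :=
  ∀ z ∈ D, ∀ w ∈ D, geodesicSegment z w ⊆ D

/-- A regular simple closed `C¹` curve in the hyperbolic plane, parametrized with period `1`.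
Differentiability is that of the curve read in the coordinate `z = x + i y`; since the curve is
`C¹` and periodic on the whole line, it is `C¹` at the closing point too. -/
structure IsSimpleClosedC1Curve (γ : ℝ → ℍ) : Prop where
  contDiff : ContDiff ℝ 1 (fun t => (γ t : ℂ))
  deriv_ne_zero : ∀ t, deriv (fun s => (γ s : ℂ)) t ≠ 0
  periodic : Function.Periodic γ 1
  injOn : InjOn γ (Ico 0 1)

/-- The hyperbolic length `∫ √(dx² + dy²) / y` of a closed curve over one period. -/
noncomputable def curveLength (γ : ℝ → ℍ) : ℝ :=
  ∫ t in (0 : ℝ)..1, ‖deriv (fun s => (γ s : ℂ)) t‖ / (γ t).im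

/-- The hyperbolic area `∫_D dx dy / y²` of a set (Mathlib's invariant measure on `ℍ`). -/
noncomputable def area (D : Set ℍ) : ℝ :=
  (volume D).toReal

/-- A hyperbolic disk: a closed ball of positive radius for the hyperbolic distance. -/
def IsDisk (D : Set ℍ) : Prop :=
  ∃ (z : ℍ) (r : ℝ), 0 < r ∧ D = Metric.closedBall z r

end HypIso

/-! The boundary is compared with the circle having the same range of heights `[a, b]`, as in Erhard
Schmidt's proof of the planar inequality. Put M = (a+b)/2, R = (b-a)/2, g = √(ab), and let X(y) be
the half-width of that circle at height y, so that (M-y)² + X² = R². Let ε be 1 on the lower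
boundary, -1 on the upper boundary and 0 elsewhere. Cauchy–Schwarz against ((M-y)/R, X/R) gives
R|γ'| ≥ ε|x'|(M-y) + |y'|X at every parameter.

Divide by y and integrate. By convexity the vertical slices of the interior are intervals, so
∫ε|x'|/y = A (`area_eq_integral`) and ∫ε|x'| = 0 (`integral_side_mul_abs_derivRe`). The height
travels from a to b and back, so ∫|y'|X/y ≥ 2∫X/y dy over [a, b], which is 2π(M-g)
(`integral_halfWidth_div`). Hence RL ≥ MA + 2π(M-g) (`linear_inequality`). Since R² = M² - g², the
square of the right side exceeds R²(4πA + A²) by a perfect square (`sq_ge_of_linear`).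

In case of equality every estimate is sharp. The height then rises once and falls once, and the
velocity has, up to signs, the components of a motion along the circle, so each half of the curve is
a possible level piece at the bottom followed by two quarter circles. Simplicity and the position of
the lower boundary exclude the level piece and fit the quarters into one circle
(`mem_circle_of_linearEq`). A compact set with interior whose frontier lies on a hyperbolic circle
is the disk (`eq_closedBall_of_frontier_subset`). Conversely, length and area of a disk come from
the same boundary integrals (`OnCircle.sq_eq`). -/

namespace HypIso

open Topology Filter

/-! ### Geodesic convexity in affine coordinates -/

/-- In the coordinates `(re, re² + im²)` geodesic segments are straight. -/
theorem mem_geodesicSegment_of_affine {z w p : ℍ} {l : ℝ} (hl0 : 0 ≤ l) (hl1 : l ≤ 1)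
    (hre : p.re = (1 - l) * z.re + l * w.re)
    (hsq : p.re ^ 2 + p.im ^ 2 =
      (1 - l) * (z.re ^ 2 + z.im ^ 2) + l * (w.re ^ 2 + w.im ^ 2)) :
    p ∈ geodesicSegment z w := by
  have hz := z.im_pos
  have hw := w.im_pos
  have hp := p.im_pos
  -- The numerator of cosh of the distance; it is affine in each argument in the coordinates `(re,
  -- re² + im²)`.
  set B : ℍ → ℍ → ℝ := fun a b => (a.re ^ 2 + a.im ^ 2 + (b.re ^ 2 + b.im ^ 2)) / 2 - a.re * b.re
    with hB
  have hcosh : ∀ a b : ℍ, Real.cosh (dist a b) = B a b / (a.im * b.im) := by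
    intro a b
    have ha := a.im_pos
    have hb := b.im_pos
    rw [UpperHalfPlane.cosh_dist', hB]
    field_simp
    ring
  -- √E is the numerator of sinh of the distance from `z` to `w`; for the two partial distances it
  -- gets multiplied by `l` and `1 - l`.
  set E := B z w ^ 2 - z.im ^ 2 * w.im ^ 2 with hE
  have hE0 : 0 ≤ E := by
    have h1 : z.im * w.im ≤ B z w := by
      simp only [hB]
      nlinarith [sq_nonneg (z.im - w.im), sq_nonneg (z.re - w.re)]
    have : 0 ≤ z.im * w.im := by positivity
    simp only [hE]
    nlinarith
  have hsinh : ∀ (a b : ℍ) (s : ℝ), 0 ≤ s → B a b ^ 2 - a.im ^ 2 * b.im ^ 2 = s ^ 2 * E →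
      Real.sinh (dist a b) = s * √E / (a.im * b.im) := by
    intro a b s hs h
    have ha := a.im_pos
    have hb := b.im_pos
    have h1 : Real.sinh (dist a b) ^ 2 = (s * √E / (a.im * b.im)) ^ 2 := by
      rw [Real.sinh_sq, hcosh, div_pow, div_pow, mul_pow s, Real.sq_sqrt hE0, ← h]
      field_simp
    exact (pow_left_inj₀ (Real.sinh_nonneg_iff.2 dist_nonneg) (by positivity) two_ne_zero).1 h1
  have hpim : p.im ^ 2 = (1 - l) * (z.re ^ 2 + z.im ^ 2) + l * (w.re ^ 2 + w.im ^ 2)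
    - ((1 - l) * z.re + l * w.re) ^ 2 := by rw [← hre]; linarith
  have hBzp : B z p = (1 - l) * z.im ^ 2 + l * B z w := by
    simp only [hB]; rw [hsq, hre]; ring
  have hBpw : B p w = (1 - l) * B z w + l * w.im ^ 2 := by
    simp only [hB]; rw [hsq, hre]; ring
  have hpim' : p.im ^ 2 = (1 - l) ^ 2 * z.im ^ 2 + 2 * l * (1 - l) * B z w + l ^ 2 * w.im ^ 2 := by
    rw [hpim]; simp only [hB]; ring
  have hs1 := hsinh z p l hl0 (by rw [hBzp, hpim', hE]; ring)
  have hs2 := hsinh p w (1 - l) (by linarith) (by rw [hBpw, hpim', hE]; ring)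
  -- The addition formula for cosh turns additivity of distances into a polynomial identity; cosh is
  -- injective on `[0, ∞)`.
  have hc : Real.cosh (dist z p + dist p w) = Real.cosh (dist z w) := by
    rw [Real.cosh_add, hs1, hs2, hcosh, hcosh, hcosh, hBzp, hBpw]
    have : l * √E / (z.im * p.im) * ((1 - l) * √E / (p.im * w.im)) =
        l * (1 - l) * E / (z.im * p.im ^ 2 * w.im) := by
      rw [div_mul_div_comm]
      congr 1
      · nlinarith [Real.mul_self_sqrt hE0]
      · ring
    rw [this]
    have h3 : ((1 - l) * z.im ^ 2 + l * B z w) * ((1 - l) * B z w + l * w.im ^ 2) + l * (1 - l) * E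
        = B z w * p.im ^ 2 := by
      rw [hpim', hE]; ring
    field_simp
    linarith
  have := Real.cosh_strictMonoOn.injOn (show dist z p + dist p w ∈ Ici (0 : ℝ) from
    add_nonneg dist_nonneg dist_nonneg) (show dist z w ∈ Ici (0 : ℝ) from dist_nonneg) hc
  exact this

/-- A point strictly between a point of a convex set and an interior point on the same vertical
line is an interior point. -/
theorem IsConvex.mem_interior_of_vertical {D : Set ℍ} (hD : IsConvex D) {p q m : ℍ}
    (hp : p ∈ D) (hq : q ∈ interior D) (hpq : p.re = q.re) (hpm : p.re = m.re)
    (h : (p.im < m.im ∧ m.im < q.im) ∨ (q.im < m.im ∧ m.im < p.im)) : m ∈ interior D := by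
  have hp0 := p.im_pos
  have hq0 := q.im_pos
  have hm0 := m.im_pos
  have hne : q.im ^ 2 - p.im ^ 2 ≠ 0 := by
    rcases h with h | h <;> intro h0 <;> nlinarith
  -- On a vertical line the affine coordinate is the squared height, so this is the parameter of `m`
  -- between `p` and `q`.
  set l := (m.im ^ 2 - p.im ^ 2) / (q.im ^ 2 - p.im ^ 2) with hl
  have hl0 : 0 < l := by
    rcases h with h | h
    · exact div_pos (by nlinarith) (by nlinarith)
    · exact div_pos_of_neg_of_neg (by nlinarith) (by nlinarith)
  have hl1 : l ≤ 1 := by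
    rcases h with h | h
    · exact (div_le_one (by nlinarith)).2 (by nlinarith)
    · exact (div_le_one_of_neg (by nlinarith)).2 (by nlinarith)
  have hlm : l * (q.im ^ 2 - p.im ^ 2) = m.im ^ 2 - p.im ^ 2 := by
    rw [hl]; field_simp
  -- Dilation from `p` by the factor `1 / l` in the affine coordinates: `u` is the new real part and
  -- `v` the new squared height. It takes `m` to `q`, so for `n` near `m` the image lies in `D`, and
  -- `n` is on the geodesic from `p` to it.
  let u : ℍ → ℝ := fun n => p.re + (n.re - p.re) / l
  let v : ℍ → ℝ := fun n =>
    p.re ^ 2 + p.im ^ 2 + (n.re ^ 2 + n.im ^ 2 - (p.re ^ 2 + p.im ^ 2)) / l - u n ^ 2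
  have hre : Continuous UpperHalfPlane.re := UpperHalfPlane.continuous_re
  have him : Continuous UpperHalfPlane.im := UpperHalfPlane.continuous_im
  have hu : Continuous u := by fun_prop
  have hv : Continuous v := by fun_prop
  have hum : u m = q.re := by simp [u, hpq, ← hpm]
  have hvm : v m = q.im ^ 2 := by
    simp only [v]
    rw [hum, ← hpq, ← hpm]
    have : (p.re ^ 2 + m.im ^ 2 - (p.re ^ 2 + p.im ^ 2)) / l = q.im ^ 2 - p.im ^ 2 := by
      rw [div_eq_iff hl0.ne', mul_comm, hlm]; ring
    rw [this]; ring
  let T : ℍ → ℍ := fun n => UpperHalfPlane.ofComplex ⟨u n, √(v n)⟩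
  have hTm : T m = q := by
    simp only [T, hum, hvm, Real.sqrt_sq hq0.le]
    exact UpperHalfPlane.ofComplex_apply q
  have hTc : ContinuousAt T m := by
    have h1 : ContinuousAt (fun n => (⟨u n, √(v n)⟩ : ℂ)) m := by
      have : (fun n => (⟨u n, √(v n)⟩ : ℂ)) = fun n => (u n : ℂ) + (√(v n) : ℝ) * Complex.I := by
        ext n; simp [Complex.mk_eq_add_mul_I]
      rw [this]
      fun_prop
    have h2 : ContinuousAt (fun c : ℂ => (UpperHalfPlane.ofComplex c : ℍ)) ⟨u m, √(v m)⟩ := by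
      rw [hum, hvm, Real.sqrt_sq hq0.le]
      have hq' : 0 < (⟨q.re, q.im⟩ : ℂ).im := hq0
      rw [UpperHalfPlane.isOpenEmbedding_coe.isInducing.continuousAt_iff]
      refine continuousAt_id.congr ?_
      filter_upwards [(isOpen_lt continuous_const Complex.continuous_im).mem_nhds hq'] with c hc
      simp [UpperHalfPlane.ofComplex_apply_of_im_pos hc]
    exact ContinuousAt.comp (f := fun n => (⟨u n, √(v n)⟩ : ℂ))
      (g := fun c : ℂ => (UpperHalfPlane.ofComplex c : ℍ)) h2 h1
  rw [mem_interior_iff_mem_nhds]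
  have e1 : ∀ᶠ n in 𝓝 m, T n ∈ D := hTc.eventually (by
    rw [hTm]; exact mem_interior_iff_mem_nhds.1 hq)
  have e2 : ∀ᶠ n in 𝓝 m, 0 < v n :=
    hv.continuousAt.eventually (lt_mem_nhds (by rw [hvm]; positivity))
  filter_upwards [e1, e2] with n h1 h2
  refine hD p hp _ h1 (mem_geodesicSegment_of_affine hl0.le hl1 ?_ ?_)
  · have : (T n).re = u n := by
      simp [T, UpperHalfPlane.ofComplex_apply_of_im_pos, h2]
    rw [this]; simp only [u]; field_simp; ring
  · have h3 : (T n).re = u n := by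
      simp [T, UpperHalfPlane.ofComplex_apply_of_im_pos, h2]
    have h4 : (T n).im = √(v n) := by
      simp [T, UpperHalfPlane.ofComplex_apply_of_im_pos, h2]
    rw [h3, h4, Real.sq_sqrt h2.le]; simp only [v]; field_simp; ring

/-- The geodesic between two points of the same height rises above that height. -/
theorem IsConvex.exists_higher {D : Set ℍ} (hD : IsConvex D) {p q : ℍ}
    (hp : p ∈ D) (hq : q ∈ D) (hpq : p ≠ q) (him : p.im = q.im) : ∃ m ∈ D, p.im < m.im := by
  have hp0 := p.im_pos
  have hre : p.re ≠ q.re := fun h => hpq (UpperHalfPlane.ext_re_im h him)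
  have hd : 0 < (p.re - q.re) ^ 2 := by
    have := sub_ne_zero.2 hre
    positivity
  have hs : p.im < √(p.im ^ 2 + (p.re - q.re) ^ 2 / 4) := by
    apply Real.lt_sqrt_of_sq_lt
    linarith
  -- The midpoint in the affine coordinates.
  refine ⟨⟨⟨(p.re + q.re) / 2, √(p.im ^ 2 + (p.re - q.re) ^ 2 / 4)⟩, hp0.trans hs⟩,
    hD p hp q hq (mem_geodesicSegment_of_affine (l := 1 / 2) (by norm_num) (by norm_num) ?_ ?_), hs⟩
  · simp; ring
  · simp only [UpperHalfPlane.mk_re, UpperHalfPlane.mk_im]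
    rw [Real.sq_sqrt (by positivity), ← him]; ring

/-! ### Vertical slices: lower and upper boundary -/

/-- The parameters at which an interior point of `D` lies vertically above the curve. -/
def lowerTimes (D : Set ℍ) (γ : ℝ → ℍ) : Set ℝ :=
  {t | ∃ q ∈ interior D, q.re = (γ t).re ∧ (γ t).im < q.im}

/-- The parameters at which an interior point of `D` lies vertically below the curve. -/
def upperTimes (D : Set ℍ) (γ : ℝ → ℍ) : Set ℝ :=
  {t | ∃ q ∈ interior D, q.re = (γ t).re ∧ q.im < (γ t).im}

/-- The interior of `D` in real coordinates. -/
def realInterior (D : Set ℍ) : Set (ℝ × ℝ) :=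
  {p | ∃ q ∈ interior D, q.re = p.1 ∧ q.im = p.2}

theorem realInterior_eq_image (D : Set ℍ) : realInterior D =
    Complex.equivRealProdCLM '' ((UpperHalfPlane.coe) '' interior D) := by
  ext ⟨a, b⟩
  simp [realInterior]

theorem isOpen_realInterior (D : Set ℍ) : IsOpen (realInterior D) := by
  rw [realInterior_eq_image]
  exact Complex.equivRealProdCLM.toHomeomorph.isOpenMap _
    (UpperHalfPlane.isOpenEmbedding_coe.isOpenMap _ isOpen_interior)

theorem mem_realInterior {D : Set ℍ} {q : ℍ} : (q.re, q.im) ∈ realInterior D ↔ q ∈ interior D := by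
  constructor
  · rintro ⟨q', h, h1, h2⟩
    rwa [← UpperHalfPlane.ext_re_im h1 h2]
  · exact fun h => ⟨q, h, rfl, rfl⟩

section curve

variable {D : Set ℍ} {γ : ℝ → ℍ}

theorem isOpen_lowerTimes (hγ : Continuous γ) : IsOpen (lowerTimes D γ) := by
  have h : lowerTimes D γ = ⋃ v : ℝ, ((fun t => ((γ t).re, v)) ⁻¹' realInterior D) ∩
      {t | (γ t).im < v} := by
    ext t
    simp only [lowerTimes, realInterior, mem_ofPred_eq, mem_iUnion, mem_inter_iff, mem_preimage]
    constructor
    · rintro ⟨q, h1, h2, h3⟩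
      exact ⟨q.im, ⟨q, h1, h2, rfl⟩, h3⟩
    · rintro ⟨v, ⟨q, h1, h2, h3⟩, h4⟩
      exact ⟨q, h1, h2, h3 ▸ h4⟩
  have hre := UpperHalfPlane.continuous_re.comp hγ
  have him := UpperHalfPlane.continuous_im.comp hγ
  rw [h]
  exact isOpen_iUnion fun v => ((isOpen_realInterior D).preimage
    (hre.prodMk continuous_const)).inter (isOpen_lt him continuous_const)

theorem isOpen_upperTimes (hγ : Continuous γ) : IsOpen (upperTimes D γ) := by
  have h : upperTimes D γ = ⋃ v : ℝ, ((fun t => ((γ t).re, v)) ⁻¹' realInterior D) ∩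
      {t | v < (γ t).im} := by
    ext t
    simp only [upperTimes, realInterior, mem_ofPred_eq, mem_iUnion, mem_inter_iff, mem_preimage]
    constructor
    · rintro ⟨q, h1, h2, h3⟩
      exact ⟨q.im, ⟨q, h1, h2, rfl⟩, h3⟩
    · rintro ⟨v, ⟨q, h1, h2, h3⟩, h4⟩
      exact ⟨q, h1, h2, h3 ▸ h4⟩
  have hre := UpperHalfPlane.continuous_re.comp hγ
  have him := UpperHalfPlane.continuous_im.comp hγ
  rw [h]
  exact isOpen_iUnion fun v => ((isOpen_realInterior D).preimage
    (hre.prodMk continuous_const)).inter (isOpen_lt continuous_const him)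

theorem injOn_Ico_of_curve (hγ : IsSimpleClosedC1Curve γ) {s t : ℝ} (hs : s ∈ Ico (0 : ℝ) 1)
    (ht : t ∈ Ico (0 : ℝ) 1) (hre : (γ s).re = (γ t).re) (him : (γ s).im = (γ t).im) : s = t :=
  hγ.injOn hs ht (UpperHalfPlane.ext_re_im hre him)

theorem IsSimpleClosedC1Curve.continuous (hγ : IsSimpleClosedC1Curve γ) : Continuous γ :=
  UpperHalfPlane.isOpenEmbedding_coe.isInducing.continuous_iff.2 hγ.contDiff.continuous

theorem frontier_notMem_interior (hb : range γ = frontier D) (t : ℝ) : γ t ∉ interior D := by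
  have : γ t ∈ frontier D := hb ▸ mem_range_self t
  exact this.2

theorem curve_mem (hcl : IsClosed D) (hb : range γ = frontier D) (t : ℝ) : γ t ∈ D :=
  hcl.frontier_subset (hb ▸ mem_range_self t)

/-- A boundary point below an interior point is the lowest point of its vertical slice. -/
theorem im_le_of_mem_lowerTimes (hD : IsConvex D) (hb : range γ = frontier D)
    {p : ℍ} (hp : p ∈ D) {t : ℝ} (ht : t ∈ lowerTimes D γ) (hre : p.re = (γ t).re) :
    (γ t).im ≤ p.im := by
  by_contra! h
  obtain ⟨q, hq, h1, h2⟩ := ht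
  exact frontier_notMem_interior hb t
    (hD.mem_interior_of_vertical hp hq (hre.trans h1.symm) hre (Or.inl ⟨h, h2⟩))

theorem im_le_of_mem_upperTimes (hD : IsConvex D) (hb : range γ = frontier D)
    {p : ℍ} (hp : p ∈ D) {t : ℝ} (ht : t ∈ upperTimes D γ) (hre : p.re = (γ t).re) :
    p.im ≤ (γ t).im := by
  by_contra! h
  obtain ⟨q, hq, h1, h2⟩ := ht
  exact frontier_notMem_interior hb t
    (hD.mem_interior_of_vertical hp hq (hre.trans h1.symm) hre (Or.inr ⟨h2, h⟩))

theorem disjoint_lower_upper (hD : IsConvex D) (hb : range γ = frontier D) :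
    Disjoint (lowerTimes D γ) (upperTimes D γ) := by
  rw [Set.disjoint_left]
  rintro t ht ⟨q, hq, h1, h2⟩
  exact (im_le_of_mem_lowerTimes hD hb (interior_subset hq) ht h1).not_gt h2

/-- Two such boundary points on one vertical line are both lowest in their slice, hence equal. This
permits the change of variables from the parameter to the abscissa. -/
theorem injOn_lowerTimes (hcl : IsClosed D) (hD : IsConvex D) (hγ : IsSimpleClosedC1Curve γ)
    (hb : range γ = frontier D) :
    InjOn (fun t => (γ t).re) (lowerTimes D γ ∩ Ico 0 1) := by
  rintro s ⟨hs, hs'⟩ t ⟨ht, ht'⟩ h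
  exact injOn_Ico_of_curve hγ hs' ht' h (le_antisymm
    (im_le_of_mem_lowerTimes hD hb (curve_mem hcl hb t) hs h.symm)
    (im_le_of_mem_lowerTimes hD hb (curve_mem hcl hb s) ht h))

theorem injOn_upperTimes (hcl : IsClosed D) (hD : IsConvex D) (hγ : IsSimpleClosedC1Curve γ)
    (hb : range γ = frontier D) :
    InjOn (fun t => (γ t).re) (upperTimes D γ ∩ Ico 0 1) := by
  rintro s ⟨hs, hs'⟩ t ⟨ht, ht'⟩ h
  exact injOn_Ico_of_curve hγ hs' ht' h (le_antisymm
    (im_le_of_mem_upperTimes hD hb (curve_mem hcl hb s) ht h)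
    (im_le_of_mem_upperTimes hD hb (curve_mem hcl hb t) hs h.symm))

theorem exists_mem_Ico_of_mem_frontier (hγ : IsSimpleClosedC1Curve γ)
    (hb : range γ = frontier D) {p : ℍ} (hp : p ∈ frontier D) :
    ∃ t ∈ Ico (0 : ℝ) 1, γ t = p := by
  rw [← hb] at hp
  obtain ⟨s, rfl⟩ := hp
  obtain ⟨t, ht, h⟩ := hγ.periodic.exists_mem_Ico₀ one_pos s
  exact ⟨t, ht, h.symm⟩

/-- Minimize the height over the compact slice; from an interior point one could still move down. -/
theorem exists_lowest (hc : IsCompact D) {q : ℍ} (hq : q ∈ interior D) :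
    ∃ p ∈ frontier D, p.re = q.re ∧ p.im < q.im := by
  have hre := UpperHalfPlane.continuous_re
  have him := UpperHalfPlane.continuous_im
  obtain ⟨p, ⟨hp, hpr⟩, hmin⟩ := (hc.inter_right (isClosed_singleton.preimage hre :
    IsClosed (UpperHalfPlane.re ⁻¹' {q.re}))).exists_isMinOn ⟨q, interior_subset hq, rfl⟩
    him.continuousOn
  have hni : p ∉ interior D := by
    intro hpi
    have h0 := p.im_pos
    have h1 : ContinuousAt (fun v : ℝ => (p.re, v)) p.im := by fun_prop
    have h2 := h1.eventually ((isOpen_realInterior D).mem_nhds (mem_realInterior.2 hpi))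
    obtain ⟨v, ⟨r, hr, hr1, hr2⟩, hv⟩ :=
      ((h2.filter_mono nhdsWithin_le_nhds).and (self_mem_nhdsWithin : Iio p.im ∈ 𝓝[<] p.im)).exists
    have : p.im ≤ r.im := hmin (show r ∈ D ∩ UpperHalfPlane.re ⁻¹' {q.re} from
      ⟨interior_subset hr, by rw [mem_preimage, hr1]; exact hpr⟩)
    have hv : v < p.im := hv
    linarith
  refine ⟨p, ⟨subset_closure hp, hni⟩, hpr, lt_of_le_of_ne (hmin ⟨interior_subset hq, rfl⟩) ?_⟩
  intro h
  exact hni (UpperHalfPlane.ext_re_im hpr h ▸ hq)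

theorem exists_highest (hc : IsCompact D) {q : ℍ} (hq : q ∈ interior D) :
    ∃ p ∈ frontier D, p.re = q.re ∧ q.im < p.im := by
  have hre := UpperHalfPlane.continuous_re
  have him := UpperHalfPlane.continuous_im
  obtain ⟨p, ⟨hp, hpr⟩, hmax⟩ := (hc.inter_right (isClosed_singleton.preimage hre :
    IsClosed (UpperHalfPlane.re ⁻¹' {q.re}))).exists_isMaxOn ⟨q, interior_subset hq, rfl⟩
    him.continuousOn
  have hni : p ∉ interior D := by
    intro hpi
    have h1 : ContinuousAt (fun v : ℝ => (p.re, v)) p.im := by fun_prop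
    have h2 := h1.eventually ((isOpen_realInterior D).mem_nhds (mem_realInterior.2 hpi))
    obtain ⟨v, ⟨r, hr, hr1, hr2⟩, hv⟩ :=
      ((h2.filter_mono nhdsWithin_le_nhds).and (self_mem_nhdsWithin : Ioi p.im ∈ 𝓝[>] p.im)).exists
    have : r.im ≤ p.im := hmax (show r ∈ D ∩ UpperHalfPlane.re ⁻¹' {q.re} from
      ⟨interior_subset hr, by rw [mem_preimage, hr1]; exact hpr⟩)
    have hv : p.im < v := hv
    linarith
  refine ⟨p, ⟨subset_closure hp, hni⟩, hpr, lt_of_le_of_ne (hmax ⟨interior_subset hq, rfl⟩) ?_⟩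
  intro h
  exact hni (UpperHalfPlane.ext_re_im hpr h.symm ▸ hq)

/-- Each vertical slice of the interior is the open interval between two points of the curve. -/
theorem exists_slice (hc : IsCompact D) (hD : IsConvex D) (hγ : IsSimpleClosedC1Curve γ)
    (hb : range γ = frontier D) {q : ℍ} (hq : q ∈ interior D) :
    ∃ t₁ ∈ lowerTimes D γ ∩ Ico 0 1, ∃ t₂ ∈ upperTimes D γ ∩ Ico 0 1,
      (γ t₁).re = q.re ∧ (γ t₂).re = q.re ∧ (γ t₁).im < (γ t₂).im ∧
      {v | (q.re, v) ∈ realInterior D} = Ioo (γ t₁).im (γ t₂).im := by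
  obtain ⟨p₁, hp₁, hr₁, hi₁⟩ := exists_lowest hc hq
  obtain ⟨p₂, hp₂, hr₂, hi₂⟩ := exists_highest hc hq
  obtain ⟨t₁, ht₁, rfl⟩ := exists_mem_Ico_of_mem_frontier hγ hb hp₁
  obtain ⟨t₂, ht₂, rfl⟩ := exists_mem_Ico_of_mem_frontier hγ hb hp₂
  have hcl := hc.isClosed
  have hl : t₁ ∈ lowerTimes D γ := ⟨q, hq, hr₁.symm, hi₁⟩
  have hu : t₂ ∈ upperTimes D γ := ⟨q, hq, hr₂.symm, hi₂⟩
  refine ⟨t₁, ⟨hl, ht₁⟩, t₂, ⟨hu, ht₂⟩, hr₁, hr₂, hi₁.trans hi₂, ?_⟩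
  ext v
  simp only [mem_ofPred_eq, mem_Ioo]
  constructor
  · rintro ⟨r, hr, hr1, hr2⟩
    simp only at hr1 hr2
    subst hr2
    refine ⟨lt_of_le_of_ne (im_le_of_mem_lowerTimes hD hb (interior_subset hr) hl (hr1.trans hr₁.symm)) ?_,
      lt_of_le_of_ne (im_le_of_mem_upperTimes hD hb (interior_subset hr) hu (hr1.trans hr₂.symm)) ?_⟩
    · intro h
      exact frontier_notMem_interior hb t₁ (UpperHalfPlane.ext_re_im (hr1.trans hr₁.symm) h.symm ▸ hr)
    · intro h
      exact frontier_notMem_interior hb t₂ (UpperHalfPlane.ext_re_im (hr1.trans hr₂.symm) h ▸ hr)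
  · rintro ⟨h1, h2⟩
    have hv : 0 < v := (γ t₁).im_pos.trans h1
    rcases lt_trichotomy v q.im with h | h | h
    · exact ⟨⟨⟨q.re, v⟩, hv⟩, hD.mem_interior_of_vertical (curve_mem hcl hb t₁) hq hr₁ hr₁
        (Or.inl ⟨h1, h⟩), rfl, rfl⟩
    · exact h ▸ mem_realInterior.2 hq
    · exact ⟨⟨⟨q.re, v⟩, hv⟩, hD.mem_interior_of_vertical (curve_mem hcl hb t₂) hq hr₂ hr₂
        (Or.inr ⟨h, h2⟩), rfl, rfl⟩

theorem image_re_lowerTimes (hc : IsCompact D) (hD : IsConvex D) (hγ : IsSimpleClosedC1Curve γ)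
    (hb : range γ = frontier D) :
    (fun t => (γ t).re) '' (lowerTimes D γ ∩ Ico 0 1) = UpperHalfPlane.re '' interior D := by
  ext u
  constructor
  · rintro ⟨t, ⟨⟨q, hq, h, -⟩, -⟩, rfl⟩
    exact ⟨q, hq, h⟩
  · rintro ⟨q, hq, rfl⟩
    obtain ⟨t₁, h₁, t₂, h₂, hr₁, hr₂, -⟩ := exists_slice hc hD hγ hb hq
    exact ⟨t₁, h₁, hr₁⟩

theorem image_re_upperTimes (hc : IsCompact D) (hD : IsConvex D) (hγ : IsSimpleClosedC1Curve γ)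
    (hb : range γ = frontier D) :
    (fun t => (γ t).re) '' (upperTimes D γ ∩ Ico 0 1) = UpperHalfPlane.re '' interior D := by
  ext u
  constructor
  · rintro ⟨t, ⟨⟨q, hq, h, -⟩, -⟩, rfl⟩
    exact ⟨q, hq, h⟩
  · rintro ⟨q, hq, rfl⟩
    obtain ⟨t₁, h₁, t₂, h₂, hr₁, hr₂, -⟩ := exists_slice hc hD hγ hb hq
    exact ⟨t₂, h₂, hr₂⟩

/-! ### The area as an integral along the boundary -/

/-- A differentiable curve in the plane has measure zero. -/
theorem volume_range_eq_zero {f : ℝ → ℂ} (hf : Differentiable ℝ f) : volume (range f) = 0 := by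
  -- Extend the curve to the plane as `z ↦ f z.re`; its derivative kills `I`, so its determinant
  -- vanishes.
  have h := addHaar_image_eq_zero_of_det_fderivWithin_eq_zero (volume : Measure ℂ) (s := univ)
    (f := fun z : ℂ => f z.re) (f' := fun z => (fderiv ℝ f z.re).comp Complex.reCLM)
    (fun z _ => ((hf z.re).hasFDerivAt.comp z Complex.reCLM.hasFDerivAt).hasFDerivWithinAt)
    (fun z _ => by
      refine LinearMap.det_eq_zero_iff_ker_ne_bot.2 ((Submodule.ne_bot_iff _).2
        ⟨Complex.I, ?_, Complex.I_ne_zero⟩)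
      simp [LinearMap.mem_ker])
  convert h
  ext w
  simp only [mem_range, image_univ]
  exact ⟨fun ⟨t, ht⟩ => ⟨t, by simpa using ht⟩, fun ⟨z, hz⟩ => ⟨z.re, hz⟩⟩

/-- The area of `D` is computed by integrating over the interior in real coordinates. -/
theorem volume_eq_lintegral_realInterior (hγ : IsSimpleClosedC1Curve γ)
    (hb : range γ = frontier D) :
    volume D = ∫⁻ p in realInterior D, ENNReal.ofReal (1 / p.2 ^ 2) := by
  have hnull : volume (frontier D) = 0 := by
    rw [UpperHalfPlane.volume_eq_lintegral, ← hb, ← range_comp]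
    apply setLIntegral_measure_zero
    exact volume_range_eq_zero (hγ.contDiff.differentiable one_ne_zero)
  have h1 : volume D = volume (interior D) := by
    apply le_antisymm _ (measure_mono interior_subset)
    have : D ⊆ interior D ∪ frontier D := by
      rw [← closure_eq_interior_union_frontier]; exact subset_closure
    calc volume D ≤ volume (interior D ∪ frontier D) := measure_mono this
      _ ≤ volume (interior D) + volume (frontier D) := measure_union_le _ _
      _ = volume (interior D) := by rw [hnull, add_zero]
  rw [h1, UpperHalfPlane.volume_eq_lintegral]
  have hp := Complex.volume_preserving_equiv_real_prod
  rw [← hp.setLIntegral_comp_preimage_emb Complex.measurableEquivRealProd.measurableEmbedding]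
  have hs : Complex.measurableEquivRealProd ⁻¹' realInterior D = UpperHalfPlane.coe '' interior D := by
    ext z
    simp only [realInterior, mem_preimage, mem_ofPred_eq, mem_image]
    constructor
    · rintro ⟨q, hq, h1, h2⟩
      exact ⟨q, hq, Complex.ext h1 h2⟩
    · rintro ⟨q, hq, rfl⟩
      exact ⟨q, hq, rfl, rfl⟩
  rw [hs]
  refine lintegral_congr fun z => ?_
  rw [ENNReal.ofReal, Complex.measurableEquivRealProd_apply]
  congr 1
  ext
  simp [sq_nonneg]

end curve

/-- The derivative of the real part of a curve. -/
noncomputable def derivRe (γ : ℝ → ℍ) (t : ℝ) : ℝ := (deriv (fun s => (γ s : ℂ)) t).re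

/-- The derivative of the imaginary part of a curve. -/
noncomputable def derivIm (γ : ℝ → ℍ) (t : ℝ) : ℝ := (deriv (fun s => (γ s : ℂ)) t).im

/-- The Euclidean speed of a curve. -/
noncomputable def speed (γ : ℝ → ℍ) (t : ℝ) : ℝ := ‖deriv (fun s => (γ s : ℂ)) t‖

section curve

variable {D : Set ℍ} {γ : ℝ → ℍ}

namespace IsSimpleClosedC1Curve

theorem continuous_deriv (hγ : IsSimpleClosedC1Curve γ) : Continuous (deriv (fun s => (γ s : ℂ))) :=
  hγ.contDiff.continuous_deriv le_rfl

theorem continuous_derivRe (hγ : IsSimpleClosedC1Curve γ) : Continuous (derivRe γ) :=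
  Complex.continuous_re.comp hγ.continuous_deriv

theorem continuous_derivIm (hγ : IsSimpleClosedC1Curve γ) : Continuous (derivIm γ) :=
  Complex.continuous_im.comp hγ.continuous_deriv

theorem continuous_speed (hγ : IsSimpleClosedC1Curve γ) : Continuous (speed γ) := hγ.continuous_deriv.norm

theorem continuous_re (hγ : IsSimpleClosedC1Curve γ) : Continuous (fun t => (γ t).re) :=
  UpperHalfPlane.continuous_re.comp hγ.continuous

theorem continuous_im (hγ : IsSimpleClosedC1Curve γ) : Continuous (fun t => (γ t).im) :=
  UpperHalfPlane.continuous_im.comp hγ.continuous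

theorem hasDerivAt_coe (hγ : IsSimpleClosedC1Curve γ) (t : ℝ) :
    HasDerivAt (fun s => (γ s : ℂ)) (deriv (fun s => (γ s : ℂ)) t) t :=
  (hγ.contDiff.differentiable one_ne_zero t).hasDerivAt

theorem hasDerivAt_re (hγ : IsSimpleClosedC1Curve γ) (t : ℝ) : HasDerivAt (fun t => (γ t).re) (derivRe γ t) t :=
  Complex.reCLM.hasFDerivAt.comp_hasDerivAt t (hγ.hasDerivAt_coe t)

theorem hasDerivAt_im (hγ : IsSimpleClosedC1Curve γ) (t : ℝ) : HasDerivAt (fun t => (γ t).im) (derivIm γ t) t :=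
  Complex.imCLM.hasFDerivAt.comp_hasDerivAt t (hγ.hasDerivAt_coe t)

theorem speed_pos (hγ : IsSimpleClosedC1Curve γ) (t : ℝ) : 0 < speed γ t := norm_pos_iff.2 (hγ.deriv_ne_zero t)

end IsSimpleClosedC1Curve

theorem speed_sq (γ : ℝ → ℍ) (t : ℝ) : speed γ t ^ 2 = derivRe γ t ^ 2 + derivIm γ t ^ 2 := by
  rw [speed, Complex.sq_norm, Complex.normSq_apply, derivRe, derivIm]; ring

theorem integrableOn_Ioo_one_div_sq {a b : ℝ} (ha : 0 < a) :
    IntegrableOn (fun v : ℝ => 1 / v ^ 2) (Ioo a b) := by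
  have : ContinuousOn (fun v : ℝ => 1 / v ^ 2) (Icc a b) := fun v hv => by
    have : v ≠ 0 := (ha.trans_le hv.1).ne'
    exact ContinuousAt.continuousWithinAt (by fun_prop (disch := positivity))
  exact this.integrableOn_Icc.mono_set Ioo_subset_Icc_self

theorem lintegral_Ioo_one_div_sq {a b : ℝ} (ha : 0 < a) (hab : a < b) :
    ∫⁻ v in Ioo a b, ENNReal.ofReal (1 / v ^ 2) = ENNReal.ofReal (1 / a - 1 / b) := by
  rw [← ofReal_integral_eq_lintegral_ofReal (integrableOn_Ioo_one_div_sq ha)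
    (Eventually.of_forall fun v => by positivity)]
  congr 1
  rw [← integral_Ioc_eq_integral_Ioo, ← intervalIntegral.integral_of_le hab.le,
    intervalIntegral.integral_eq_sub_of_hasDerivAt (f := fun v => -(1 / v))]
  · ring
  · intro v hv
    rw [uIcc_of_le hab.le] at hv
    have : v ≠ 0 := (ha.trans_le hv.1).ne'
    have h := (hasDerivAt_inv this).fun_neg
    simpa [one_div] using h
  · rw [intervalIntegrable_iff_integrableOn_Ioo_of_le hab.le]
    exact integrableOn_Ioo_one_div_sq ha

theorem integrableOn_Ico_of_continuous {f : ℝ → ℝ} (hf : Continuous f) (s : Set ℝ) :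
    IntegrableOn f (s ∩ Ico 0 1) :=
  (hf.integrableOn_Icc (a := 0) (b := 1)).mono_set (inter_subset_right.trans Ico_subset_Icc_self)

/-- Fubini along vertical lines: a slice from height f to height g contributes 1/f - 1/g.
Substituting the abscissa of the curve for the variable turns the two terms into integrals over the
lower and upper parameters. -/
theorem area_eq_sub (hc : IsCompact D) (hD : IsConvex D) (hγ : IsSimpleClosedC1Curve γ)
    (hb : range γ = frontier D) :
    area D = (∫ t in lowerTimes D γ ∩ Ico 0 1, |derivRe γ t| / (γ t).im) -
      ∫ t in upperTimes D γ ∩ Ico 0 1, |derivRe γ t| / (γ t).im := by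
  have hcl := hc.isClosed
  set L := lowerTimes D γ ∩ Ico 0 1 with hL
  set U := upperTimes D γ ∩ Ico 0 1 with hU
  set X := UpperHalfPlane.re '' interior D with hX
  have hLm : MeasurableSet L := (isOpen_lowerTimes hγ.continuous).measurableSet.inter measurableSet_Ico
  have hUm : MeasurableSet U := (isOpen_upperTimes hγ.continuous).measurableSet.inter measurableSet_Ico
  have hXm : MeasurableSet X :=
    (UpperHalfPlane.isOpenMap_re _ isOpen_interior).measurableSet
  have hLi := injOn_lowerTimes (D := D) hcl hD hγ hb
  have hUi := injOn_upperTimes (D := D) hcl hD hγ hb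
  rw [← hL] at hLi
  rw [← hU] at hUi
  have hLX : (fun t => (γ t).re) '' L = X := image_re_lowerTimes hc hD hγ hb
  have hUX : (fun t => (γ t).re) '' U = X := image_re_upperTimes hc hD hγ hb
  -- Heights of the lower and upper boundary over the abscissa `u`; the values off `X` are arbitrary
  -- but still positive.
  let f : ℝ → ℝ := fun u => (γ (Function.invFunOn (fun t => (γ t).re) L u)).im
  let g : ℝ → ℝ := fun u => (γ (Function.invFunOn (fun t => (γ t).re) U u)).im
  have hf : ∀ t ∈ L, f (γ t).re = (γ t).im := fun t ht => by
    simp only [f]; rw [hLi.leftInvOn_invFunOn ht]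
  have hg : ∀ t ∈ U, g (γ t).re = (γ t).im := fun t ht => by
    simp only [g]; rw [hUi.leftInvOn_invFunOn ht]
  have hcont : Continuous fun t => |derivRe γ t| / (γ t).im :=
    hγ.continuous_derivRe.abs.div hγ.continuous_im fun t => (γ t).im_ne_zero
  have hfint : IntegrableOn (fun u => 1 / f u) X := by
    rw [← hLX, integrableOn_image_iff_integrableOn_abs_deriv_smul hLm
      (fun t _ => (hγ.hasDerivAt_re t).hasDerivWithinAt) hLi]
    refine (integrableOn_Ico_of_continuous hcont _).congr_fun (fun t ht => ?_) hLm
    simp only [smul_eq_mul]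
    rw [hf t ht, mul_one_div]
  have hgint : IntegrableOn (fun u => 1 / g u) X := by
    rw [← hUX, integrableOn_image_iff_integrableOn_abs_deriv_smul hUm
      (fun t _ => (hγ.hasDerivAt_re t).hasDerivWithinAt) hUi]
    refine (integrableOn_Ico_of_continuous hcont _).congr_fun (fun t ht => ?_) hUm
    simp only [smul_eq_mul]
    rw [hg t ht, mul_one_div]
  have hfI : ∫ u in X, 1 / f u = ∫ t in L, |derivRe γ t| / (γ t).im := by
    rw [← hLX, integral_image_eq_integral_abs_deriv_smul hLm
      (fun t _ => (hγ.hasDerivAt_re t).hasDerivWithinAt) hLi]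
    refine setIntegral_congr_fun hLm (fun t ht => ?_)
    simp only [smul_eq_mul]
    rw [hf t ht, mul_one_div]
  have hgI : ∫ u in X, 1 / g u = ∫ t in U, |derivRe γ t| / (γ t).im := by
    rw [← hUX, integral_image_eq_integral_abs_deriv_smul hUm
      (fun t _ => (hγ.hasDerivAt_re t).hasDerivWithinAt) hUi]
    refine setIntegral_congr_fun hUm (fun t ht => ?_)
    simp only [smul_eq_mul]
    rw [hg t ht, mul_one_div]
  have hslice : ∀ u ∈ X, f u < g u ∧ {v | (u, v) ∈ realInterior D} = Ioo (f u) (g u) := by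
    rintro u ⟨q, hq, rfl⟩
    obtain ⟨t₁, h₁, t₂, h₂, hr₁, hr₂, hlt, hs⟩ := exists_slice hc hD hγ hb hq
    have e1 := hf t₁ h₁
    have e2 := hg t₂ h₂
    rw [hr₁] at e1
    rw [hr₂] at e2
    rw [e1, e2]
    exact ⟨hlt, hs⟩
  have hf0 : ∀ u, 0 < f u := fun u => UpperHalfPlane.im_pos _
  have hvol : volume D = ENNReal.ofReal (∫ u in X, (1 / f u - 1 / g u)) := by
    rw [volume_eq_lintegral_realInterior hγ hb,
      ← lintegral_indicator (isOpen_realInterior D).measurableSet, Measure.volume_eq_prod,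
      lintegral_prod]
    · have hfg : IntegrableOn (fun u => 1 / f u - 1 / g u) X := hfint.sub hgint
      rw [ofReal_integral_eq_lintegral_ofReal hfg, ← lintegral_indicator hXm]
      · refine lintegral_congr fun u => ?_
        by_cases hu : u ∈ X
        · obtain ⟨h1, h2⟩ := hslice u hu
          rw [indicator_of_mem hu, ← lintegral_Ioo_one_div_sq (hf0 u) h1, ← h2,
            ← lintegral_indicator (by rw [h2]; exact measurableSet_Ioo)]
          rfl
        · rw [indicator_of_notMem hu, lintegral_eq_zero_of_ae_eq_zero]
          refine Eventually.of_forall fun v => ?_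
          refine indicator_of_notMem ?_ _
          rintro ⟨q, hq, h1, -⟩
          exact hu ⟨q, hq, h1⟩
      · refine (ae_restrict_iff' hXm).2 (Eventually.of_forall fun u hu => ?_)
        have := (hslice u hu).1
        simp only [Pi.zero_apply, sub_nonneg]
        exact one_div_le_one_div_of_le (hf0 u) this.le
    · refine Measurable.aemeasurable (Measurable.indicator ?_ (isOpen_realInterior D).measurableSet)
      fun_prop
  rw [area, hvol, ENNReal.toReal_ofReal, integral_sub hfint hgint, hfI, hgI]
  refine setIntegral_nonneg hXm fun u hu => ?_
  have := (hslice u hu).1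
  simp only [sub_nonneg]
  exact one_div_le_one_div_of_le (hf0 u) this.le

/-- Both sides are the length of the projection of the interior to the real axis. -/
theorem integral_abs_derivRe_eq (hc : IsCompact D) (hD : IsConvex D)
    (hγ : IsSimpleClosedC1Curve γ) (hb : range γ = frontier D) :
    ∫ t in lowerTimes D γ ∩ Ico 0 1, |derivRe γ t| =
      ∫ t in upperTimes D γ ∩ Ico 0 1, |derivRe γ t| := by
  have hcl := hc.isClosed
  have h1 := integral_image_eq_integral_abs_deriv_smul
    ((isOpen_lowerTimes (D := D) hγ.continuous).measurableSet.inter measurableSet_Ico)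
      (fun t _ => (hγ.hasDerivAt_re t).hasDerivWithinAt) (injOn_lowerTimes hcl hD hγ hb)
      (fun _ => (1 : ℝ))
  have h2 := integral_image_eq_integral_abs_deriv_smul
    ((isOpen_upperTimes (D := D) hγ.continuous).measurableSet.inter measurableSet_Ico)
      (fun t _ => (hγ.hasDerivAt_re t).hasDerivWithinAt) (injOn_upperTimes hcl hD hγ hb)
      (fun _ => (1 : ℝ))
  rw [image_re_lowerTimes hc hD hγ hb] at h1
  rw [image_re_upperTimes hc hD hγ hb] at h2
  simp only [smul_eq_mul, mul_one] at h1 h2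
  rw [← h1, ← h2]

/-- `1` below the interior of `D`, `-1` above it. -/
noncomputable def side (D : Set ℍ) (γ : ℝ → ℍ) (t : ℝ) : ℝ :=
  (lowerTimes D γ).indicator 1 t - (upperTimes D γ).indicator 1 t

theorem measurable_side (hγ : Continuous γ) : Measurable (side D γ) :=
  (measurable_one.indicator (isOpen_lowerTimes hγ).measurableSet).sub
    (measurable_one.indicator (isOpen_upperTimes hγ).measurableSet)

theorem abs_side_le (D : Set ℍ) (γ : ℝ → ℍ) (t : ℝ) : |side D γ t| ≤ 1 := by
  unfold side
  by_cases h1 : t ∈ lowerTimes D γ <;> by_cases h2 : t ∈ upperTimes D γ <;> simp [h1, h2]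

theorem intervalIntegrable_side_mul (hγ : Continuous γ) {f : ℝ → ℝ} (hf : Continuous f)
    (a b : ℝ) : IntervalIntegrable (fun t => side D γ t * f t) volume a b := by
  refine (hf.norm.intervalIntegrable a b).mono_fun ?_ ?_
  · exact ((measurable_side hγ).mul hf.measurable).aestronglyMeasurable
  · refine Eventually.of_forall fun t => ?_
    simp only [norm_mul, norm_norm]
    exact mul_le_of_le_one_left (norm_nonneg _) (abs_side_le D γ t)

theorem integral_side_mul (hγ : Continuous γ) {f : ℝ → ℝ} (hf : Continuous f) :
    ∫ t in (0 : ℝ)..1, side D γ t * f t =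
      (∫ t in lowerTimes D γ ∩ Ico 0 1, f t) - ∫ t in upperTimes D γ ∩ Ico 0 1, f t := by
  have hl := (isOpen_lowerTimes (D := D) hγ).measurableSet
  have hu := (isOpen_upperTimes (D := D) hγ).measurableSet
  have hfi : IntegrableOn f (Ico 0 1) := by
    have := integrableOn_Ico_of_continuous hf univ
    rwa [univ_inter] at this
  rw [intervalIntegral.integral_of_le zero_le_one, integral_Ioc_eq_integral_Ioo,
    ← integral_Ico_eq_integral_Ioo, inter_comm (lowerTimes D γ), ← setIntegral_indicator hl,
    inter_comm (upperTimes D γ), ← setIntegral_indicator hu,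
    ← integral_sub (hfi.indicator hl) (hfi.indicator hu)]
  refine integral_congr_ae (Eventually.of_forall fun t => ?_)
  simp only [side]
  by_cases h1 : t ∈ lowerTimes D γ <;> by_cases h2 : t ∈ upperTimes D γ <;> simp [h1, h2]

theorem area_eq_integral (hc : IsCompact D) (hD : IsConvex D) (hγ : IsSimpleClosedC1Curve γ)
    (hb : range γ = frontier D) :
    area D = ∫ t in (0 : ℝ)..1, side D γ t * (|derivRe γ t| / (γ t).im) := by
  rw [integral_side_mul hγ.continuous, area_eq_sub hc hD hγ hb]
  exact hγ.continuous_derivRe.abs.div hγ.continuous_im fun t => (γ t).im_ne_zero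

theorem integral_side_mul_abs_derivRe (hc : IsCompact D) (hD : IsConvex D)
    (hγ : IsSimpleClosedC1Curve γ) (hb : range γ = frontier D) :
    ∫ t in (0 : ℝ)..1, side D γ t * |derivRe γ t| = 0 := by
  rw [integral_side_mul hγ.continuous hγ.continuous_derivRe.abs,
    integral_abs_derivRe_eq hc hD hγ hb, sub_self]

end curve

/-! ### The comparison circle: half-width, angles and their integrals -/

/-- Half the width at height `y` of the Euclidean disk whose heights range over `[a, b]`. -/
noncomputable def halfWidth (a b y : ℝ) : ℝ := √((y - a) * (b - y))

theorem continuous_halfWidth (a b : ℝ) : Continuous (halfWidth a b) := by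
  unfold halfWidth; fun_prop

theorem halfWidth_nonneg (a b y : ℝ) : 0 ≤ halfWidth a b y := Real.sqrt_nonneg _

theorem halfWidth_pos {a b y : ℝ} (h1 : a < y) (h2 : y < b) : 0 < halfWidth a b y :=
  Real.sqrt_pos.2 (mul_pos (sub_pos.2 h1) (sub_pos.2 h2))

theorem halfWidth_sq {a b y : ℝ} (h1 : a ≤ y) (h2 : y ≤ b) :
    halfWidth a b y ^ 2 = ((b - a) / 2) ^ 2 - ((a + b) / 2 - y) ^ 2 := by
  rw [halfWidth, Real.sq_sqrt (mul_nonneg (sub_nonneg.2 h1) (sub_nonneg.2 h2))]; ring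

@[simp] theorem halfWidth_left (a b : ℝ) : halfWidth a b a = 0 := by simp [halfWidth]

@[simp] theorem halfWidth_right (a b : ℝ) : halfWidth a b b = 0 := by simp [halfWidth]

theorem halfWidth_mid {a b : ℝ} (h : a ≤ b) : halfWidth a b ((a + b) / 2) = (b - a) / 2 := by
  rw [halfWidth, show ((a + b) / 2 - a) * (b - (a + b) / 2) = ((b - a) / 2) ^ 2 by ring,
    Real.sqrt_sq (by linarith)]

theorem hasDerivAt_halfWidth {a b y : ℝ} (h1 : a < y) (h2 : y < b) :
    HasDerivAt (halfWidth a b) (((a + b) / 2 - y) / halfWidth a b y) y := by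
  have h0 : (y - a) * (b - y) ≠ 0 := (mul_pos (sub_pos.2 h1) (sub_pos.2 h2)).ne'
  have h := (((hasDerivAt_id y).sub_const a).mul ((hasDerivAt_id y).const_sub b)).sqrt h0
  refine h.congr_deriv ?_
  have hp := (halfWidth_pos h1 h2).ne'
  simp only [id, Pi.mul_apply]
  change _ / (2 * halfWidth a b y) = _
  field_simp
  ring

/-- The angle at the Euclidean centre. -/
noncomputable def euclAngle (a b y : ℝ) : ℝ := Real.arcsin ((y - (a + b) / 2) / ((b - a) / 2))

/-- The angle at the hyperbolic centre. -/
noncomputable def hypAngle (a b y : ℝ) : ℝ :=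
  Real.arcsin (((a + b) / 2 * y - a * b) / ((b - a) / 2 * y))

theorem hasDerivAt_euclAngle {a b y : ℝ} (h1 : a < y) (h2 : y < b) :
    HasDerivAt (euclAngle a b) (1 / halfWidth a b y) y := by
  have hR : 0 < (b - a) / 2 := by linarith
  have hba : b - a ≠ 0 := by linarith
  have hX := halfWidth_pos h1 h2
  have hs : √(1 - ((y - (a + b) / 2) / ((b - a) / 2)) ^ 2) = halfWidth a b y / ((b - a) / 2) := by
    rw [← Real.sqrt_sq (div_nonneg hX.le hR.le), div_pow (halfWidth a b y),
      halfWidth_sq h1.le h2.le]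
    congr 1
    field_simp
    ring
  have h3 : -1 < (y - (a + b) / 2) / ((b - a) / 2) := by rw [lt_div_iff₀ hR]; linarith
  have h4 : (y - (a + b) / 2) / ((b - a) / 2) < 1 := by rw [div_lt_iff₀ hR]; linarith
  have h := (Real.hasDerivAt_arcsin h3.ne' h4.ne).comp y
    (((hasDerivAt_id y).sub_const ((a + b) / 2)).div_const ((b - a) / 2))
  refine h.congr_deriv ?_
  simp only [id] at *
  rw [hs]
  field_simp

theorem hasDerivAt_hypAngle {a b y : ℝ} (ha : 0 < a) (h1 : a < y) (h2 : y < b) :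
    HasDerivAt (hypAngle a b) (√(a * b) / (y * halfWidth a b y)) y := by
  have hR : 0 < (b - a) / 2 := by linarith
  have hba : b - a ≠ 0 := by linarith
  have hX := halfWidth_pos h1 h2
  have hy : 0 < y := ha.trans h1
  have hab : 0 < a * b := mul_pos ha (hy.trans h2)
  have hg : 0 < √(a * b) := Real.sqrt_pos.2 hab
  have hg2 : √(a * b) ^ 2 = a * b := Real.sq_sqrt hab.le
  -- The cosine of the angle at the hyperbolic centre, in terms of the half-width.
  have hs : √(1 - (((a + b) / 2 * y - a * b) / ((b - a) / 2 * y)) ^ 2) =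
      √(a * b) * halfWidth a b y / ((b - a) / 2 * y) := by
    rw [← Real.sqrt_sq (by positivity : 0 ≤ √(a * b) * halfWidth a b y / ((b - a) / 2 * y)),
      div_pow (√(a * b) * _), mul_pow (√(a * b)), hg2, halfWidth_sq h1.le h2.le]
    congr 1
    field_simp
    ring
  have hRy : 0 < (b - a) / 2 * y := by positivity
  have h3 : -1 < ((a + b) / 2 * y - a * b) / ((b - a) / 2 * y) := by
    rw [lt_div_iff₀ hRy]; nlinarith
  have h4 : ((a + b) / 2 * y - a * b) / ((b - a) / 2 * y) < 1 := by
    rw [div_lt_iff₀ hRy]; nlinarith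
  have h := (Real.hasDerivAt_arcsin h3.ne' h4.ne).comp y
    ((((hasDerivAt_id y).const_mul ((a + b) / 2)).sub_const (a * b)).div
      ((hasDerivAt_id y).const_mul ((b - a) / 2)) hRy.ne')
  refine h.congr_deriv ?_
  simp only [id] at *
  rw [hs]
  field_simp
  rw [hg2]
  ring

theorem euclAngle_left {a b : ℝ} (h : a < b) : euclAngle a b a = -(Real.pi / 2) := by
  rw [euclAngle, show (a - (a + b) / 2) / ((b - a) / 2) = -1 by
    have : b - a ≠ 0 := by linarith
    field_simp; ring, Real.arcsin_neg_one]

theorem euclAngle_right {a b : ℝ} (h : a < b) : euclAngle a b b = Real.pi / 2 := by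
  rw [euclAngle, show (b - (a + b) / 2) / ((b - a) / 2) = 1 by
    have : b - a ≠ 0 := by linarith
    field_simp; ring, Real.arcsin_one]

theorem hypAngle_left {a b : ℝ} (ha : 0 < a) (h : a < b) : hypAngle a b a = -(Real.pi / 2) := by
  rw [hypAngle, show ((a + b) / 2 * a - a * b) / ((b - a) / 2 * a) = -1 by
    have : b - a ≠ 0 := by linarith
    field_simp; ring, Real.arcsin_neg_one]

theorem hypAngle_right {a b : ℝ} (ha : 0 < a) (h : a < b) : hypAngle a b b = Real.pi / 2 := by
  rw [hypAngle, show ((a + b) / 2 * b - a * b) / ((b - a) / 2 * b) = 1 by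
    have : b - a ≠ 0 := by linarith
    have : b ≠ 0 := by linarith
    field_simp; ring, Real.arcsin_one]

theorem continuous_euclAngle (a b : ℝ) : Continuous (euclAngle a b) := by
  unfold euclAngle; fun_prop

theorem continuousOn_hypAngle {a b : ℝ} (ha : 0 < a) (h : a < b) :
    ContinuousOn (hypAngle a b) (Icc a b) := by
  refine Real.continuous_arcsin.comp_continuousOn (ContinuousOn.div (by fun_prop) (by fun_prop) ?_)
  intro y hy
  have : 0 < y := ha.trans_le hy.1
  have : 0 < b - a := by linarith
  positivity

theorem continuousOn_halfWidth_div {a b : ℝ} (ha : 0 < a) :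
    ContinuousOn (fun y => halfWidth a b y / y) (Icc a b) :=
  (continuous_halfWidth a b).continuousOn.div continuousOn_id fun _ hy => (ha.trans_le hy.1).ne'

theorem integral_halfWidth_div {a b : ℝ} (ha : 0 < a) (hab : a < b) :
    ∫ y in a..b, halfWidth a b y / y = Real.pi * ((a + b) / 2 - √(a * b)) := by
  have hp : 0 < a * b := mul_pos ha (ha.trans hab)
  -- With X² = 2My - y² - ab one has X/y = (M-y)/X + M/X - ab/(yX), and each term is a derivative
  -- found above. Only the two angles contribute at the endpoints.
  rw [intervalIntegral.integral_eq_sub_of_hasDerivAt_of_le hab.le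
    (f := fun y => halfWidth a b y + (a + b) / 2 * euclAngle a b y - √(a * b) * hypAngle a b y)]
  · simp only [halfWidth_left, halfWidth_right, euclAngle_left hab, euclAngle_right hab,
      hypAngle_left ha hab, hypAngle_right ha hab]
    ring
  · exact ((continuous_halfWidth a b).continuousOn.add
      ((continuous_euclAngle a b).continuousOn.const_mul _)).sub
      ((continuousOn_hypAngle ha hab).const_mul _)
  · intro y hy
    have h := ((hasDerivAt_halfWidth hy.1 hy.2).fun_add
      ((hasDerivAt_euclAngle hy.1 hy.2).const_mul ((a + b) / 2))).fun_sub
      ((hasDerivAt_hypAngle ha hy.1 hy.2).const_mul √(a * b))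
    refine h.congr_deriv ?_
    have hX := halfWidth_pos hy.1 hy.2
    have hy0 : 0 < y := ha.trans hy.1
    have hg2 : √(a * b) ^ 2 = a * b := Real.sq_sqrt hp.le
    have hX2 := halfWidth_sq hy.1.le hy.2.le
    field_simp
    rw [hg2, hX2]
    ring
  · exact (continuousOn_halfWidth_div ha).intervalIntegrable_of_Icc hab.le

/-! ### The linear inequality and its squared form -/

/-- Cauchy–Schwarz against the unit vector `((M - y) / R, X / R)`. -/
theorem mul_add_mul_le {e q v m X R : ℝ} (hR : 0 ≤ R) (hv : 0 ≤ v) (he : e ^ 2 + q ^ 2 ≤ v ^ 2)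
    (hm : m ^ 2 + X ^ 2 = R ^ 2) : e * m + q * X ≤ v * R := by
  refine (le_abs_self _).trans (abs_le_of_sq_le_sq ?_ (by positivity))
  have h : (e ^ 2 + q ^ 2) * R ^ 2 ≤ v ^ 2 * R ^ 2 := by gcongr
  rw [← hm] at h
  rw [mul_pow, ← hm]
  linarith [sq_nonneg (e * X - q * m)]

/-- The equality case of `mul_add_mul_le`. -/
theorem eq_of_mul_add_mul_eq {e q v m X R : ℝ} (he : e ^ 2 + q ^ 2 ≤ v ^ 2)
    (hm : m ^ 2 + X ^ 2 = R ^ 2) (h : e * m + q * X = v * R) :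
    e * R = v * m ∧ q * R = v * X := by
  have h1 : (e ^ 2 + q ^ 2) * R ^ 2 ≤ v ^ 2 * R ^ 2 := by gcongr
  have h2 : (e * R - v * m) ^ 2 + (q * R - v * X) ^ 2 ≤ 0 := by
    have : (e * R - v * m) ^ 2 + (q * R - v * X) ^ 2 =
        (e ^ 2 + q ^ 2) * R ^ 2 - 2 * R * v * (e * m + q * X) + v ^ 2 * (m ^ 2 + X ^ 2) := by ring
    rw [this, h, hm]
    linarith
  have h3 := sq_nonneg (e * R - v * m)
  have h4 := sq_nonneg (q * R - v * X)
  constructor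
  · exact sub_eq_zero.1 (pow_eq_zero_iff two_ne_zero |>.1 (by linarith))
  · exact sub_eq_zero.1 (pow_eq_zero_iff two_ne_zero |>.1 (by linarith))

/-- A simple closed curve parametrized so that it starts at a lowest point; `t₁` is the parameter
of a highest point. -/
structure IsNormalized (γ : ℝ → ℍ) (t₁ : ℝ) : Prop where
  curve : IsSimpleClosedC1Curve γ
  mem : t₁ ∈ Ioo (0 : ℝ) 1
  low : ∀ t, (γ 0).im ≤ (γ t).im
  high : ∀ t, (γ t).im ≤ (γ t₁).im
  lt : (γ 0).im < (γ t₁).im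

section curve

variable {D : Set ℍ} {γ : ℝ → ℍ} {a b t₁ : ℝ}

theorem IsNormalized.one (h : IsNormalized γ t₁) : γ 1 = γ 0 := by
  have := h.curve.periodic 0
  rwa [zero_add] at this

/-- The vertical part of the boundary integral. -/
noncomputable def vertical (a b : ℝ) (γ : ℝ → ℍ) (t : ℝ) : ℝ :=
  derivIm γ t * (halfWidth a b (γ t).im / (γ t).im)

theorem continuous_vertical (hγ : IsSimpleClosedC1Curve γ) : Continuous (vertical a b γ) :=
  hγ.continuous_derivIm.mul (((continuous_halfWidth a b).comp hγ.continuous_im).div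
    hγ.continuous_im fun t => (γ t).im_ne_zero)

theorem integral_vertical (hγ : IsSimpleClosedC1Curve γ) (ha : 0 < a)
    (hl : ∀ t, a ≤ (γ t).im) (hh : ∀ t, (γ t).im ≤ b) (s t : ℝ) :
    ∫ u in s..t, vertical a b γ u = ∫ y in (γ s).im..(γ t).im, halfWidth a b y / y := by
  have h := intervalIntegral.integral_comp_mul_deriv' (a := s) (b := t)
    (f := fun t => (γ t).im) (f' := derivIm γ) (g := fun y => halfWidth a b y / y)
    (fun x _ => hγ.hasDerivAt_im x) hγ.continuous_derivIm.continuousOn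
    ((continuousOn_halfWidth_div ha).mono (by
      rintro _ ⟨u, -, rfl⟩
      exact ⟨hl u, hh u⟩))
  rw [← h]
  refine intervalIntegral.integral_congr fun u _ => ?_
  simp only [vertical, Function.comp]
  ring

/-- By substitution the signed integrals over `[0, t₁]` and `[t₁, 1]` depend only on the end
heights, however the curve oscillates. The two remaining integrals are nonnegative and measure the
failure of the height to rise once and fall once. -/
theorem integral_abs_vertical_split (h : IsNormalized γ t₁) :
    ∫ u in (0 : ℝ)..1, |vertical (γ 0).im (γ t₁).im γ u| =
      2 * (Real.pi * (((γ 0).im + (γ t₁).im) / 2 - √((γ 0).im * (γ t₁).im))) +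
      (∫ u in (0 : ℝ)..t₁, (|vertical (γ 0).im (γ t₁).im γ u| - vertical (γ 0).im (γ t₁).im γ u)) +
      ∫ u in t₁..1, (|vertical (γ 0).im (γ t₁).im γ u| + vertical (γ 0).im (γ t₁).im γ u) := by
  have hc := continuous_vertical (a := (γ 0).im) (b := (γ t₁).im) h.curve
  have hi : ∀ s t, IntervalIntegrable (vertical (γ 0).im (γ t₁).im γ) volume s t :=
    fun s t => hc.intervalIntegrable s t
  have hi' : ∀ s t, IntervalIntegrable (fun u => |vertical (γ 0).im (γ t₁).im γ u|) volume s t :=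
    fun s t => hc.abs.intervalIntegrable s t
  rw [intervalIntegral.integral_sub (hi' _ _) (hi _ _),
    intervalIntegral.integral_add (hi' _ _) (hi _ _),
    ← intervalIntegral.integral_add_adjacent_intervals (hi' 0 t₁) (hi' t₁ 1),
    integral_vertical h.curve (γ 0).im_pos h.low h.high,
    integral_vertical h.curve (γ 0).im_pos h.low h.high, h.one,
    intervalIntegral.integral_symm (γ 0).im (γ t₁).im,
    integral_halfWidth_div (γ 0).im_pos h.lt]
  ring

theorem integral_abs_vertical_ge (h : IsNormalized γ t₁) :
    2 * (Real.pi * (((γ 0).im + (γ t₁).im) / 2 - √((γ 0).im * (γ t₁).im))) ≤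
      ∫ u in (0 : ℝ)..1, |vertical (γ 0).im (γ t₁).im γ u| := by
  rw [integral_abs_vertical_split h]
  have h1 : 0 ≤ ∫ u in (0 : ℝ)..t₁,
      (|vertical (γ 0).im (γ t₁).im γ u| - vertical (γ 0).im (γ t₁).im γ u) :=
    intervalIntegral.integral_nonneg h.mem.1.le fun u _ => sub_nonneg.2 (le_abs_self _)
  have h2 : 0 ≤ ∫ u in t₁..1,
      (|vertical (γ 0).im (γ t₁).im γ u| + vertical (γ 0).im (γ t₁).im γ u) :=
    intervalIntegral.integral_nonneg h.mem.2.le fun u _ => by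
      linarith [neg_abs_le (vertical (γ 0).im (γ t₁).im γ u)]
  linarith

theorem eq_zero_of_integral_eq_zero {f : ℝ → ℝ} {s t : ℝ} (hf : Continuous f) (hf0 : ∀ u, 0 ≤ f u)
    (hst : s < t) (h : ∫ u in s..t, f u = 0) : ∀ u ∈ Icc s t, f u = 0 := by
  intro u hu
  by_contra hne
  have := intervalIntegral.integral_pos hst hf.continuousOn (fun x _ => hf0 x)
    ⟨u, hu, lt_of_le_of_ne (hf0 u) (Ne.symm hne)⟩
  linarith

theorem vertical_sign_of_eq (h : IsNormalized γ t₁)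
    (heq : ∫ u in (0 : ℝ)..1, |vertical (γ 0).im (γ t₁).im γ u| =
      2 * (Real.pi * (((γ 0).im + (γ t₁).im) / 2 - √((γ 0).im * (γ t₁).im)))) :
    (∀ u ∈ Icc 0 t₁, 0 ≤ vertical (γ 0).im (γ t₁).im γ u) ∧
      ∀ u ∈ Icc t₁ 1, vertical (γ 0).im (γ t₁).im γ u ≤ 0 := by
  have hc := continuous_vertical (a := (γ 0).im) (b := (γ t₁).im) h.curve
  rw [integral_abs_vertical_split h] at heq
  have n1 : ∀ u, 0 ≤ |vertical (γ 0).im (γ t₁).im γ u| - vertical (γ 0).im (γ t₁).im γ u :=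
    fun u => sub_nonneg.2 (le_abs_self _)
  have n2 : ∀ u, 0 ≤ |vertical (γ 0).im (γ t₁).im γ u| + vertical (γ 0).im (γ t₁).im γ u :=
    fun u => by linarith [neg_abs_le (vertical (γ 0).im (γ t₁).im γ u)]
  have c1 : Continuous fun u => |vertical (γ 0).im (γ t₁).im γ u| - vertical (γ 0).im (γ t₁).im γ u :=
    hc.abs.sub hc
  have c2 : Continuous fun u => |vertical (γ 0).im (γ t₁).im γ u| + vertical (γ 0).im (γ t₁).im γ u :=
    hc.abs.add hc
  have h1 := intervalIntegral.integral_nonneg (μ := volume) h.mem.1.le fun u _ => n1 u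
  have h2 := intervalIntegral.integral_nonneg (μ := volume) h.mem.2.le fun u _ => n2 u
  constructor
  · intro u hu
    have := eq_zero_of_integral_eq_zero c1 n1 h.mem.1 (by linarith) u hu
    linarith [abs_nonneg (vertical (γ 0).im (γ t₁).im γ u)]
  · intro u hu
    have := eq_zero_of_integral_eq_zero c2 n2 h.mem.2 (by linarith) u hu
    linarith [abs_nonneg (vertical (γ 0).im (γ t₁).im γ u)]

/-- The defect in the pointwise Cauchy–Schwarz inequality between the curve and the circle of the
same range of heights. -/
noncomputable def defect (D : Set ℍ) (a b : ℝ) (γ : ℝ → ℍ) (t : ℝ) : ℝ :=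
  (b - a) / 2 * (speed γ t / (γ t).im) -
    side D γ t * (|derivRe γ t| * (((a + b) / 2 - (γ t).im) / (γ t).im)) - |vertical a b γ t|

theorem defect_eq (D : Set ℍ) (a b : ℝ) (γ : ℝ → ℍ) (t : ℝ) :
    defect D a b γ t = (speed γ t * ((b - a) / 2) - (side D γ t * |derivRe γ t| *
      ((a + b) / 2 - (γ t).im) + |derivIm γ t| * halfWidth a b (γ t).im)) / (γ t).im := by
  have h0 := (γ t).im_pos
  rw [defect, vertical, abs_mul, abs_of_nonneg (div_nonneg (halfWidth_nonneg a b _) h0.le)]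
  field_simp
  ring

/-- Only an inequality, because `side` may vanish, for instance along vertical pieces of the
boundary. -/
theorem side_sq_add_le (D : Set ℍ) (γ : ℝ → ℍ) (t : ℝ) :
    (side D γ t * |derivRe γ t|) ^ 2 + |derivIm γ t| ^ 2 ≤ speed γ t ^ 2 := by
  rw [speed_sq, mul_pow, sq_abs, sq_abs]
  have h1 : side D γ t ^ 2 ≤ 1 := by
    rw [sq_le_one_iff_abs_le_one]; exact abs_side_le D γ t
  have h2 : side D γ t ^ 2 * derivRe γ t ^ 2 ≤ 1 * derivRe γ t ^ 2 := by gcongr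
  linarith

theorem defect_nonneg (D : Set ℍ) {t : ℝ} (hl : a ≤ (γ t).im) (hh : (γ t).im ≤ b) :
    0 ≤ defect D a b γ t := by
  rw [defect_eq]
  refine div_nonneg (sub_nonneg.2 (mul_add_mul_le (by linarith) (norm_nonneg _)
    (side_sq_add_le D γ t) ?_)) (γ t).im_pos.le
  rw [halfWidth_sq hl hh]; ring

theorem intervalIntegrable_defect (hγ : IsSimpleClosedC1Curve γ) (s t : ℝ) :
    IntervalIntegrable (defect D a b γ) volume s t := by
  have h0 : ∀ t, (γ t).im ≠ 0 := fun t => (γ t).im_ne_zero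
  have c0 := hγ.continuous_im
  refine ((Continuous.intervalIntegrable ?_ s t).sub
    (intervalIntegrable_side_mul hγ.continuous ?_ s t)).sub
    ((continuous_vertical hγ).abs.intervalIntegrable s t)
  · exact continuous_const.mul (hγ.continuous_speed.div c0 h0)
  · exact hγ.continuous_derivRe.abs.mul ((continuous_const.sub c0).div c0 h0)

/-- Split (M-y)/y as M/y - 1: the first term yields the area, and the second integrates to zero
against ε|x'|. -/
theorem integral_defect (hc : IsCompact D) (hD : IsConvex D) (hγ : IsSimpleClosedC1Curve γ)
    (hb : range γ = frontier D) (a b : ℝ) :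
    ∫ t in (0 : ℝ)..1, defect D a b γ t = (b - a) / 2 * curveLength γ - (a + b) / 2 * area D -
      ∫ t in (0 : ℝ)..1, |vertical a b γ t| := by
  have h0 : ∀ t, (γ t).im ≠ 0 := fun t => (γ t).im_ne_zero
  have c0 := hγ.continuous_im
  have i1 : IntervalIntegrable (fun t => (b - a) / 2 * (speed γ t / (γ t).im)) volume 0 1 :=
    (continuous_const.mul (hγ.continuous_speed.div c0 h0)).intervalIntegrable _ _
  have i2 : IntervalIntegrable (fun t => (a + b) / 2 * (side D γ t * (|derivRe γ t| / (γ t).im)))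
      volume 0 1 :=
    (intervalIntegrable_side_mul hγ.continuous (hγ.continuous_derivRe.abs.div c0 h0) 0 1).const_mul _
  have i3 : IntervalIntegrable (fun t => side D γ t * |derivRe γ t|) volume 0 1 :=
    intervalIntegrable_side_mul hγ.continuous hγ.continuous_derivRe.abs 0 1
  have i4 : IntervalIntegrable (fun t => |vertical a b γ t|) volume 0 1 :=
    (continuous_vertical hγ).abs.intervalIntegrable _ _
  have e : ∀ t, defect D a b γ t = (b - a) / 2 * (speed γ t / (γ t).im) -
      ((a + b) / 2 * (side D γ t * (|derivRe γ t| / (γ t).im)) - side D γ t * |derivRe γ t|) -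
      |vertical a b γ t| := by
    intro t
    have := h0 t
    rw [defect]
    field_simp
  simp_rw [e]
  rw [intervalIntegral.integral_sub (i1.sub (i2.sub i3)) i4,
    intervalIntegral.integral_sub i1 (i2.sub i3), intervalIntegral.integral_sub i2 i3,
    integral_side_mul_abs_derivRe hc hD hγ hb, intervalIntegral.integral_const_mul,
    intervalIntegral.integral_const_mul, ← area_eq_integral hc hD hγ hb, sub_zero]
  rfl

/-- The linear (Bonnesen type) inequality behind the isoperimetric inequality. -/
theorem linear_inequality (hc : IsCompact D) (hD : IsConvex D) (h : IsNormalized γ t₁)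
    (hb : range γ = frontier D) :
    ((γ 0).im + (γ t₁).im) / 2 * area D +
      2 * (Real.pi * (((γ 0).im + (γ t₁).im) / 2 - √((γ 0).im * (γ t₁).im))) ≤
      ((γ t₁).im - (γ 0).im) / 2 * curveLength γ := by
  have h1 := integral_defect hc hD h.curve hb (γ 0).im (γ t₁).im
  have h2 := integral_abs_vertical_ge h
  have h3 : 0 ≤ ∫ t in (0 : ℝ)..1, defect D (γ 0).im (γ t₁).im γ t :=
    intervalIntegral.integral_nonneg zero_le_one fun t _ => defect_nonneg D (h.low t) (h.high t)
  linarith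

/-- The isoperimetric inequality follows from the linear inequality, as does its equality case. -/
theorem sq_ge_of_linear {L A a b : ℝ} (ha : 0 < a) (hab : a < b) (hA : 0 ≤ A)
    (h : (a + b) / 2 * A + 2 * (Real.pi * ((a + b) / 2 - √(a * b))) ≤ (b - a) / 2 * L) :
    4 * Real.pi * A + A ^ 2 ≤ L ^ 2 ∧ (L ^ 2 = 4 * Real.pi * A + A ^ 2 →
      (b - a) / 2 * L = (a + b) / 2 * A + 2 * (Real.pi * ((a + b) / 2 - √(a * b)))) := by
  set g := √(a * b) with hg
  have hg2 : g ^ 2 = a * b := Real.sq_sqrt (by nlinarith)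
  have hgM : g ≤ (a + b) / 2 := by
    rw [hg, Real.sqrt_le_left (by linarith)]
    nlinarith [sq_nonneg (a - b)]
  set K := (a + b) / 2 * A + 2 * (Real.pi * ((a + b) / 2 - g)) with hK
  have hK0 : 0 ≤ K := by
    have : 0 ≤ (a + b) / 2 - g := by linarith
    have := Real.pi_pos
    have : 0 ≤ (a + b) / 2 := by linarith
    positivity
  have hR : 0 < (b - a) / 2 := by linarith
  -- The discriminant identity, which rests on R² = M² - g².
  have key : K ^ 2 - ((b - a) / 2) ^ 2 * (4 * Real.pi * A + A ^ 2) =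
      (A * g - 2 * Real.pi * ((a + b) / 2 - g)) ^ 2 := by
    have : ((b - a) / 2) ^ 2 = ((a + b) / 2) ^ 2 - g ^ 2 := by rw [hg2]; ring
    rw [this, hK]; ring
  have hKL : K ^ 2 ≤ ((b - a) / 2) ^ 2 * L ^ 2 := by
    rw [← mul_pow]; exact pow_le_pow_left₀ hK0 h 2
  constructor
  · have : ((b - a) / 2) ^ 2 * (4 * Real.pi * A + A ^ 2) ≤ ((b - a) / 2) ^ 2 * L ^ 2 := by
      linarith [sq_nonneg (A * g - 2 * Real.pi * ((a + b) / 2 - g))]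
    exact le_of_mul_le_mul_left this (by positivity)
  -- Now K² ≤ R²L² by the linear inequality and R²L² ≤ K² by `key`.
  · intro hL
    rw [hL] at hKL
    refine (pow_left_inj₀ (hK0.trans h) hK0 two_ne_zero).1 ?_
    rw [mul_pow, hL]
    linarith [sq_nonneg (A * g - 2 * Real.pi * ((a + b) / 2 - g))]

end curve

/-! ### Arcs determined by the speed components of a circle -/

theorem pos_or_neg_of_ne_zero {k : ℝ → ℝ} {p q : ℝ} (hk : Continuous k)
    (h0 : ∀ t ∈ Ioo p q, k t ≠ 0) : (∀ t ∈ Ioo p q, 0 < k t) ∨ ∀ t ∈ Ioo p q, k t < 0 := by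
  by_contra! h
  obtain ⟨⟨t, ht, h1⟩, ⟨u, hu, h2⟩⟩ := h
  obtain ⟨w, hw, h3⟩ := isPreconnected_Ioo.intermediate_value ht hu hk.continuousOn ⟨h1, h2⟩
  exact h0 w hw h3

theorem eq_of_deriv_eq_zero {F : ℝ → ℝ} {p q : ℝ} (hF : Continuous F)
    (h : ∀ t ∈ Ioo p q, HasDerivAt F 0 t) {s t : ℝ} (hs : s ∈ Icc p q) (ht : t ∈ Icc p q) :
    F s = F t := by
  have h1 : MonotoneOn F (Icc p q) := monotoneOn_of_deriv_nonneg (convex_Icc p q) hF.continuousOn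
    (by rw [interior_Icc]; exact fun u hu => (h u hu).differentiableAt.differentiableWithinAt)
    (by rw [interior_Icc]; exact fun u hu => (h u hu).deriv.ge)
  have h2 : AntitoneOn F (Icc p q) := antitoneOn_of_deriv_nonpos (convex_Icc p q) hF.continuousOn
    (by rw [interior_Icc]; exact fun u hu => (h u hu).differentiableAt.differentiableWithinAt)
    (by rw [interior_Icc]; exact fun u hu => (h u hu).deriv.le)
  rcases le_total s t with hst | hst
  · exact le_antisymm (h1 hs ht hst) (h2 hs ht hst)
  · exact le_antisymm (h2 ht hs hst) (h1 ht hs hst)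

/-- A curve with the speed components of a circle runs along a quarter of the circle while its
height stays on one side of the centre. -/
theorem exists_sign_of_arc {x y x' y' v : ℝ → ℝ} {a b p q : ℝ}
    (hx : ∀ t, HasDerivAt x (x' t) t) (hy : ∀ t, HasDerivAt y (y' t) t) (cx : Continuous x')
    (hv : ∀ t, 0 < v t) (hab : a < b)
    (hI : ∀ t ∈ Ioo p q, a < y t ∧ y t < b ∧ y t ≠ (a + b) / 2)
    (hX : ∀ t ∈ Ioo p q, |x' t| * ((b - a) / 2) = v t * |(a + b) / 2 - y t|)
    (hY : ∀ t ∈ Ioo p q, y' t * ((b - a) / 2) = v t * halfWidth a b (y t)) :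
    ∃ σ : ℝ, (σ = 1 ∨ σ = -1) ∧ ∀ s ∈ Icc p q, ∀ t ∈ Icc p q,
      x s - σ * halfWidth a b (y s) = x t - σ * halfWidth a b (y t) := by
  have hR : 0 < (b - a) / 2 := by linarith
  have cxx : Continuous x := continuous_iff_continuousAt.2 fun t => (hx t).continuousAt
  have cy : Continuous y := continuous_iff_continuousAt.2 fun t => (hy t).continuousAt
  have hk : ∀ t ∈ Ioo p q, x' t * ((a + b) / 2 - y t) ≠ 0 := by
    intro t ht
    have h1 := sub_ne_zero.2 (hI t ht).2.2.symm
    refine mul_ne_zero (fun h0 => ?_) h1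
    have h2 := hX t ht
    rw [h0, abs_zero, zero_mul] at h2
    exact (mul_pos (hv t) (abs_pos.2 h1)).ne h2
  -- Away from the height of the centre x' cannot vanish, so σ, the sign of x'(M-y), is constant; it
  -- tells on which side of the centre the arc lies.
  obtain ⟨σ, hσ, hs⟩ : ∃ σ : ℝ, (σ = 1 ∨ σ = -1) ∧
      ∀ t ∈ Ioo p q, 0 < σ * (x' t * ((a + b) / 2 - y t)) := by
    rcases pos_or_neg_of_ne_zero (cx.mul (continuous_const.sub cy)) hk with h | h
    · exact ⟨1, Or.inl rfl, fun t ht => by rw [one_mul]; exact h t ht⟩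
    · exact ⟨-1, Or.inr rfl, fun t ht => by
        have : x' t * ((a + b) / 2 - y t) < 0 := h t ht
        linarith⟩
  refine ⟨σ, hσ, fun s hs' t ht' => ?_⟩
  have hσ2 : σ ^ 2 = 1 := by rcases hσ with h | h <;> rw [h] <;> norm_num
  -- This function is the abscissa of the centre of the circle; both its terms have derivative
  -- σv(M-y)/R.
  refine eq_of_deriv_eq_zero (F := fun t => x t - σ * halfWidth a b (y t)) (p := p) (q := q)
    (cxx.sub (continuous_const.mul ((continuous_halfWidth a b).comp cy))) (fun u hu => ?_) hs' ht'
  obtain ⟨h1, h2, h3⟩ := hI u hu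
  refine ((hx u).sub (((hasDerivAt_halfWidth h1 h2).comp u (hy u)).const_mul σ)).congr_deriv ?_
  have hX0 := (halfWidth_pos h1 h2).ne'
  have hy' : y' u = v u * halfWidth a b (y u) / ((b - a) / 2) := by
    rw [eq_div_iff hR.ne']; exact hY u hu
  have hx' : x' u * ((b - a) / 2) = σ * (v u * ((a + b) / 2 - y u)) := by
    have e1 : (x' u * ((b - a) / 2)) ^ 2 = (σ * (v u * ((a + b) / 2 - y u))) ^ 2 := by
      have := congrArg (· ^ 2) (hX u hu)
      simp only [mul_pow, sq_abs] at this
      rw [mul_pow, mul_pow, hσ2, one_mul, mul_pow]; exact this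
    rcases sq_eq_sq_iff_eq_or_eq_neg.1 e1 with e | e
    · exact e
    · exfalso
      have p1 := mul_pos hR (hs u hu)
      have p2 : (b - a) / 2 * (σ * (x' u * ((a + b) / 2 - y u))) =
        - (σ ^ 2 * v u * ((a + b) / 2 - y u) ^ 2) := by linear_combination (σ * ((a + b) / 2 - y u)) * e
      rw [p2, hσ2] at p1
      have := hv u
      have : 0 ≤ 1 * v u * ((a + b) / 2 - y u) ^ 2 := by positivity
      linarith
  have hx'' : x' u = σ * (v u * ((a + b) / 2 - y u)) / ((b - a) / 2) := by
    rw [eq_div_iff hR.ne']; exact hx'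
  rw [hy', hx'']
  field_simp
  ring

/-- A curve rising from height `a` to height `b` with the speed components of a circle consists,
after a level piece at the bottom, of two quarters of circles. -/
theorem exists_quarters {x y x' y' v : ℝ → ℝ} {a b T : ℝ} (hT : 0 ≤ T)
    (hx : ∀ t, HasDerivAt x (x' t) t) (hy : ∀ t, HasDerivAt y (y' t) t) (cx : Continuous x')
    (hv : ∀ t, 0 < v t) (hab : a < b) (hlow : ∀ t, a ≤ y t) (hhigh : ∀ t, y t ≤ b)
    (y0 : y 0 = a) (yT : y T = b) (htop : ∀ t ∈ Icc 0 T, y t = b → t = T)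
    (hX : ∀ t ∈ Icc 0 T, |x' t| * ((b - a) / 2) = v t * |(a + b) / 2 - y t|)
    (hY : ∀ t ∈ Icc 0 T, y' t * ((b - a) / 2) = v t * halfWidth a b (y t)) :
    ∃ s q σ τ : ℝ, 0 ≤ s ∧ s < q ∧ q < T ∧ (∀ t ∈ Icc 0 s, y t = a) ∧ y q = (a + b) / 2 ∧
      (σ = 1 ∨ σ = -1) ∧ (τ = 1 ∨ τ = -1) ∧
      (∀ t ∈ Icc s q, x t = x s + σ * halfWidth a b (y t)) ∧
      (∀ t ∈ Icc q T, x t = x T + τ * halfWidth a b (y t)) ∧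
      ∀ t ∈ Ioo s q, a < y t ∧ y t < (a + b) / 2 := by
  have hR : 0 < (b - a) / 2 := by linarith
  have cy : Continuous y := continuous_iff_continuousAt.2 fun t => (hy t).continuousAt
  have hmono : MonotoneOn y (Icc 0 T) := by
    refine monotoneOn_of_deriv_nonneg (convex_Icc 0 T) cy.continuousOn
      (fun t _ => (hy t).differentiableAt.differentiableWithinAt) fun t ht => ?_
    rw [(hy t).deriv]
    have := hY t (interior_subset ht)
    have h1 := mul_nonneg (hv t).le (halfWidth_nonneg a b (y t))
    rw [← this] at h1
    exact nonneg_of_mul_nonneg_left h1 hR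
  -- `s` is the last time at the bottom height; nothing so far excludes a level piece before it.
  obtain ⟨s, ⟨hs, hsa⟩, hmax⟩ := (isCompact_Icc.inter_right (isClosed_singleton.preimage cy :
    IsClosed (y ⁻¹' {a}))).exists_isGreatest ⟨0, ⟨le_rfl, hT⟩, y0⟩
  have hsa : y s = a := hsa
  have hsT : s < T := lt_of_le_of_ne hs.2 fun h => by
    rw [h, yT] at hsa; exact hab.ne' hsa
  have hbetween : ∀ t ∈ Ioo s T, a < y t ∧ y t < b := by
    intro t ht
    have ht' : t ∈ Icc 0 T := ⟨hs.1.trans ht.1.le, ht.2.le⟩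
    refine ⟨lt_of_le_of_ne (hlow t) fun h => ?_, lt_of_le_of_ne (hhigh t) fun h => ?_⟩
    · exact (hmax ⟨ht', h.symm⟩).not_gt ht.1
    · exact ht.2.ne (htop t ht' h)
  have hsub : Icc s T ⊆ Icc 0 T := Icc_subset_Icc_left hs.1
  have hstrict : StrictMonoOn y (Icc s T) := by
    refine strictMonoOn_of_deriv_pos (convex_Icc s T) cy.continuousOn fun t ht => ?_
    rw [interior_Icc] at ht
    rw [(hy t).deriv]
    have h1 := mul_pos (hv t) (halfWidth_pos (hbetween t ht).1 (hbetween t ht).2)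
    rw [← hY t (hsub (Ioo_subset_Icc_self ht))] at h1
    exact pos_of_mul_pos_left h1 hR.le
  -- At the height of the centre x' vanishes and may change sign, so the two quarters get
  -- independent signs σ and τ.
  obtain ⟨q, hq, hqM⟩ := intermediate_value_Ioo hsT.le cy.continuousOn
    (show (a + b) / 2 ∈ Ioo (y s) (y T) by rw [hsa, yT]; constructor <;> linarith)
  have hqI : q ∈ Icc s T := Ioo_subset_Icc_self hq
  have hlt : ∀ t ∈ Ioo s q, a < y t ∧ y t < (a + b) / 2 := fun t ht =>
    ⟨(hbetween t ⟨ht.1, ht.2.trans hq.2⟩).1,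
      hqM ▸ hstrict ⟨ht.1.le, (ht.2.trans hq.2).le⟩ hqI ht.2⟩
  have hgt : ∀ t ∈ Ioo q T, (a + b) / 2 < y t := fun t ht =>
    hqM ▸ hstrict hqI ⟨(hq.1.trans ht.1).le, ht.2.le⟩ ht.1
  have hsub1 : Ioo s q ⊆ Icc 0 T := fun t ht => ⟨hs.1.trans ht.1.le, (ht.2.trans hq.2).le⟩
  have hsub2 : Ioo q T ⊆ Icc 0 T := fun t ht => ⟨hs.1.trans (hq.1.trans ht.1).le, ht.2.le⟩
  obtain ⟨σ, hσ, h1⟩ := exists_sign_of_arc (a := a) (b := b) hx hy cx hv hab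
    (fun t ht => ⟨(hlt t ht).1, (hbetween t ⟨ht.1, ht.2.trans hq.2⟩).2, (hlt t ht).2.ne⟩)
    (fun t ht => hX t (hsub1 ht)) fun t ht => hY t (hsub1 ht)
  obtain ⟨τ, hτ, h2⟩ := exists_sign_of_arc (a := a) (b := b) hx hy cx hv hab
    (fun t ht => ⟨(hbetween t ⟨hq.1.trans ht.1, ht.2⟩).1, (hbetween t ⟨hq.1.trans ht.1, ht.2⟩).2,
      (hgt t ht).ne'⟩)
    (fun t ht => hX t (hsub2 ht)) fun t ht => hY t (hsub2 ht)
  refine ⟨s, q, σ, τ, hs.1, hq.1, hq.2, fun t ht => ?_, hqM, hσ, hτ, fun t ht => ?_, fun t ht => ?_,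
    hlt⟩
  · exact le_antisymm (hsa ▸ hmono ⟨ht.1, ht.2.trans hs.2⟩ hs ht.2) (hlow t)
  · have := h1 t ht s ⟨le_rfl, hq.1.le⟩
    rw [hsa, halfWidth_left] at this
    linarith
  · have := h2 t ht T ⟨hq.2.le, le_rfl⟩
    rw [yT, halfWidth_right] at this
    linarith

/-! ### Equality forces the boundary onto a circle -/

section curve

variable {D : Set ℍ} {γ : ℝ → ℍ} {a b t₁ : ℝ}

theorem im_le_of_mem (hc : IsCompact D) (hb : range γ = frontier D)
    (hh : ∀ t, (γ t).im ≤ b) {p : ℍ} (hp : p ∈ D) : p.im ≤ b := by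
  have hf : ∀ r ∈ frontier D, r.im ≤ b := by
    intro r hr
    rw [← hb] at hr
    obtain ⟨t, rfl⟩ := hr
    exact hh t
  by_cases hi : p ∈ interior D
  · obtain ⟨r, hr, -, hlt⟩ := exists_highest hc hi
    exact hlt.le.trans (hf r hr)
  · exact hf p ⟨subset_closure hp, hi⟩

/-- Geodesics bulge upward, so a second highest point would produce a still higher one. This fails
at the bottom, hence the level pieces there. -/
theorem eq_of_im_eq_high (hc : IsCompact D) (hD : IsConvex D) (h : IsNormalized γ t₁)
    (hb : range γ = frontier D) {t : ℝ} (ht : (γ t).im = (γ t₁).im) : γ t = γ t₁ := by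
  by_contra hne
  obtain ⟨m, hm, hlt⟩ := hD.exists_higher (curve_mem hc.isClosed hb t)
    (curve_mem hc.isClosed hb t₁) hne ht
  rw [ht] at hlt
  exact (im_le_of_mem hc hb h.high hm).not_gt hlt

/-- Reversal of a curve. -/
def reversed (γ : ℝ → ℍ) (t : ℝ) : ℍ := γ (1 - t)

theorem deriv_reversed (γ : ℝ → ℍ) (t : ℝ) :
    deriv (fun s => (reversed γ s : ℂ)) t = -deriv (fun s => (γ s : ℂ)) (1 - t) :=
  deriv_comp_const_sub (f := fun s => (γ s : ℂ)) 1 t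

theorem range_reversed (γ : ℝ → ℍ) : range (reversed γ) = range γ :=
  (Equiv.subLeft (1 : ℝ)).surjective.range_comp γ

theorem curveLength_reversed (γ : ℝ → ℍ) : curveLength (reversed γ) = curveLength γ := by
  have := intervalIntegral.integral_comp_sub_left (a := 0) (b := 1)
    (fun t => ‖deriv (fun s => (γ s : ℂ)) t‖ / (γ t).im) 1
  rw [sub_self, sub_zero] at this
  rw [curveLength, curveLength, ← this]
  refine intervalIntegral.integral_congr fun t _ => ?_
  simp only [deriv_reversed, norm_neg]
  rfl

/-- Reversal exchanges the two half-open fundamental intervals, so injectivity is needed on the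
other one. -/
theorem IsSimpleClosedC1Curve.eq_of_eq (hγ : IsSimpleClosedC1Curve γ) {s t : ℝ} (h : γ s = γ t)
    (hs : s ∈ Ioc (0 : ℝ) 1) (ht : t ∈ Ioc (0 : ℝ) 1) : s = t := by
  have h1 : γ 1 = γ 0 := by have := hγ.periodic 0; rwa [zero_add] at this
  rcases eq_or_lt_of_le hs.2 with rfl | hs1 <;> rcases eq_or_lt_of_le ht.2 with rfl | ht1
  · rfl
  · rw [h1] at h
    exact absurd (hγ.injOn ⟨le_rfl, one_pos⟩ ⟨ht.1.le, ht1⟩ h) ht.1.ne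
  · rw [h1] at h
    exact absurd (hγ.injOn ⟨hs.1.le, hs1⟩ ⟨le_rfl, one_pos⟩ h) hs.1.ne'
  · exact hγ.injOn ⟨hs.1.le, hs1⟩ ⟨ht.1.le, ht1⟩ h

theorem IsSimpleClosedC1Curve.reversed (hγ : IsSimpleClosedC1Curve γ) :
    IsSimpleClosedC1Curve (reversed γ) where
  contDiff := hγ.contDiff.comp (contDiff_const.sub contDiff_id)
  deriv_ne_zero t := by rw [deriv_reversed]; exact neg_ne_zero.2 (hγ.deriv_ne_zero _)
  periodic t := by
    have := hγ.periodic (1 - (t + 1))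
    rw [show 1 - (t + 1) + 1 = 1 - t by ring] at this
    exact this.symm
  injOn s hs t ht h := by
    have := hγ.eq_of_eq (s := 1 - s) (t := 1 - t) h ⟨by linarith [hs.2], by linarith [hs.1]⟩
      ⟨by linarith [ht.2], by linarith [ht.1]⟩
    linarith

theorem IsNormalized.reversed (h : IsNormalized γ t₁) : IsNormalized (reversed γ) (1 - t₁) := by
  have h0 : HypIso.reversed γ 0 = γ 0 := by rw [HypIso.reversed, sub_zero, h.one]
  have h1 : HypIso.reversed γ (1 - t₁) = γ t₁ := by rw [HypIso.reversed, sub_sub_cancel]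
  refine ⟨h.curve.reversed, ⟨by linarith [h.mem.2], by linarith [h.mem.1]⟩, fun t => ?_, fun t => ?_,
    ?_⟩
  · rw [h0]; exact h.low _
  · rw [h1]; exact h.high _
  · rw [h0, h1]; exact h.lt

/-- Equality in the linear inequality. -/
def LinearEq (D : Set ℍ) (γ : ℝ → ℍ) (t₁ : ℝ) : Prop :=
  ((γ t₁).im - (γ 0).im) / 2 * curveLength γ = ((γ 0).im + (γ t₁).im) / 2 * area D +
    2 * (Real.pi * (((γ 0).im + (γ t₁).im) / 2 - √((γ 0).im * (γ t₁).im)))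

theorem LinearEq.reversed (h : IsNormalized γ t₁) (he : LinearEq D γ t₁) :
    LinearEq D (reversed γ) (1 - t₁) := by
  have h0 : HypIso.reversed γ 0 = γ 0 := by rw [HypIso.reversed, sub_zero, h.one]
  have h1 : HypIso.reversed γ (1 - t₁) = γ t₁ := by rw [HypIso.reversed, sub_sub_cancel]
  rw [LinearEq, h0, h1, curveLength_reversed]
  exact he

/-- The linear inequality drops the integral of the defect and the excess of the vertical integral,
both nonnegative; equality makes both zero. The first identity holds only almost everywhere because
`side` is discontinuous. -/
theorem ae_eq_of_linearEq (hc : IsCompact D) (hD : IsConvex D) (h : IsNormalized γ t₁)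
    (hb : range γ = frontier D) (he : LinearEq D γ t₁) :
    (∀ᵐ t ∂volume.restrict (Icc 0 1),
      side D γ t * |derivRe γ t| * (((γ t₁).im - (γ 0).im) / 2) =
        speed γ t * (((γ 0).im + (γ t₁).im) / 2 - (γ t).im) ∧
      |derivIm γ t| * (((γ t₁).im - (γ 0).im) / 2) =
        speed γ t * halfWidth (γ 0).im (γ t₁).im (γ t).im) ∧
    ∀ u ∈ Icc 0 t₁, 0 ≤ vertical (γ 0).im (γ t₁).im γ u := by
  have h1 := integral_defect hc hD h.curve hb (γ 0).im (γ t₁).im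
  have h2 := integral_abs_vertical_ge h
  have h3 : 0 ≤ ∫ t in (0 : ℝ)..1, defect D (γ 0).im (γ t₁).im γ t :=
    intervalIntegral.integral_nonneg zero_le_one fun t _ => defect_nonneg D (h.low t) (h.high t)
  have he' := he
  unfold LinearEq at he'
  have h4 : ∫ t in (0 : ℝ)..1, defect D (γ 0).im (γ t₁).im γ t = 0 := by linarith
  refine ⟨?_, (vertical_sign_of_eq h (by linarith)).1⟩
  have h5 := (intervalIntegral.integral_eq_zero_iff_of_nonneg_ae (μ := volume) (a := 0) (b := 1)
    (Eventually.of_forall fun t => by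
      exact defect_nonneg D (h.low t) (h.high t)) (intervalIntegrable_defect h.curve 0 1)).1 h4
  -- The criterion for interval integrals also involves the reversed interval, which is empty here.
  rw [Ioc_eq_empty (by norm_num : ¬ (1 : ℝ) < 0), union_empty] at h5
  rw [restrict_Ioc_eq_restrict_Icc] at h5
  filter_upwards [h5] with t ht
  rw [defect_eq, Pi.zero_apply, div_eq_zero_iff, or_iff_left (γ t).im_ne_zero, sub_eq_zero] at ht
  refine eq_of_mul_add_mul_eq (side_sq_add_le D γ t) ?_ ht.symm
  rw [halfWidth_sq (h.low t) (h.high t)]; ring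

end curve

section curve

variable {D : Set ℍ} {γ : ℝ → ℍ} {a b t₁ : ℝ}

/-- The identity for y' involves continuous functions only, so it holds everywhere; the one for |x'|
follows from |γ'|² = x'² + y'², without the discontinuous `side`. -/
theorem speed_eq_of_linearEq (hc : IsCompact D) (hD : IsConvex D) (h : IsNormalized γ t₁)
    (hb : range γ = frontier D) (he : LinearEq D γ t₁) :
    ∀ t ∈ Icc (0 : ℝ) 1, |derivIm γ t| * (((γ t₁).im - (γ 0).im) / 2) =
        speed γ t * halfWidth (γ 0).im (γ t₁).im (γ t).im ∧
      |derivRe γ t| * (((γ t₁).im - (γ 0).im) / 2) =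
        speed γ t * |((γ 0).im + (γ t₁).im) / 2 - (γ t).im| := by
  have hR : 0 < ((γ t₁).im - (γ 0).im) / 2 := by have := h.lt; linarith
  have e := Measure.eqOn_Icc_of_ae_eq volume zero_ne_one
    ((ae_eq_of_linearEq hc hD h hb he).1.mono fun t ht => ht.2)
    (h.curve.continuous_derivIm.abs.mul continuous_const).continuousOn
    (h.curve.continuous_speed.mul
      ((continuous_halfWidth _ _).comp h.curve.continuous_im)).continuousOn
  intro t ht
  have e1 : |derivIm γ t| * (((γ t₁).im - (γ 0).im) / 2) =
        speed γ t * halfWidth (γ 0).im (γ t₁).im (γ t).im := e ht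
  refine ⟨e1, ?_⟩
  refine (pow_left_inj₀ (by positivity)
    (mul_nonneg (h.curve.speed_pos t).le (abs_nonneg _)) two_ne_zero).1 ?_
  have e2 := congrArg (· ^ 2) e1
  simp only [mul_pow, sq_abs] at e2 ⊢
  rw [halfWidth_sq (h.low t) (h.high t)] at e2
  have e3 := speed_sq γ t
  linear_combination (-(((γ t₁).im - (γ 0).im) / 2) ^ 2) * e3 - e2

/-- In the equality case the rising part of the curve consists, after a level piece at the bottom,
of two quarters of circles, the first of which lies on the lower boundary. -/
theorem exists_quarters_of_linearEq (hc : IsCompact D) (hD : IsConvex D) (h : IsNormalized γ t₁)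
    (hb : range γ = frontier D) (he : LinearEq D γ t₁) :
    ∃ s q σ τ : ℝ, 0 ≤ s ∧ s < q ∧ q < t₁ ∧ (∀ t ∈ Icc 0 s, (γ t).im = (γ 0).im) ∧
      (γ q).im = ((γ 0).im + (γ t₁).im) / 2 ∧
      (σ = 1 ∨ σ = -1) ∧ (τ = 1 ∨ τ = -1) ∧
      (∀ t ∈ Icc s q, (γ t).re = (γ s).re + σ * halfWidth (γ 0).im (γ t₁).im (γ t).im) ∧
      (∀ t ∈ Icc q t₁, (γ t).re = (γ t₁).re + τ * halfWidth (γ 0).im (γ t₁).im (γ t).im) ∧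
      ∀ c, σ * ((γ s).re - c) < 0 → ∃ t ∈ lowerTimes D γ, (γ 0).im < (γ t).im ∧
        (γ t).re ∈ uIcc (γ s).re c := by
  have hR : 0 < ((γ t₁).im - (γ 0).im) / 2 := by have := h.lt; linarith
  have hsub : Icc 0 t₁ ⊆ Icc (0 : ℝ) 1 := Icc_subset_Icc_right h.mem.2.le
  have hsp := speed_eq_of_linearEq hc hD h hb he
  obtain ⟨hae, hsg⟩ := ae_eq_of_linearEq hc hD h hb he
  obtain ⟨s, q, σ, τ, hs0, hsq, hqt, hflat, hqM, hσ, hτ, h1, h2, h3⟩ :=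
    exists_quarters (x := fun t => (γ t).re) (y := fun t => (γ t).im) h.mem.1.le
      h.curve.hasDerivAt_re h.curve.hasDerivAt_im h.curve.continuous_derivRe
      h.curve.speed_pos h.lt h.low h.high rfl rfl
      (fun t ht ht' => h.curve.injOn ⟨ht.1, ht.2.trans_lt h.mem.2⟩ ⟨h.mem.1.le, h.mem.2⟩
        (eq_of_im_eq_high hc hD h hb ht'))
      (fun t ht => (hsp t (hsub ht)).2) (fun t ht => by
        have e := (hsp t (hsub ht)).1
        rw [← e]
        congr 1
        -- The sign of `vertical` fixes that of y' where the half-width is positive; where it is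
        -- zero, y' vanishes.
        rcases (halfWidth_nonneg (γ 0).im (γ t₁).im (γ t).im).eq_or_lt with h0 | h0
        · rw [← h0, mul_zero, mul_eq_zero, or_iff_left hR.ne'] at e
          rw [e, abs_eq_zero.1 e]
        · exact (abs_of_nonneg (nonneg_of_mul_nonneg_left (hsg t ht)
            (div_pos h0 (γ t).im_pos))).symm)
  refine ⟨s, q, σ, τ, hs0, hsq, hqt, hflat, hqM, hσ, hτ, h1, h2, fun c hcs => ?_⟩
  have hcont : ContinuousAt (fun t => σ * ((γ t).re - c)) s :=
    (continuous_const.mul (h.curve.continuous_re.sub continuous_const)).continuousAt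
  -- For a short time after `s` the arc, which leaves `γ s` towards `c`, has not yet reached the
  -- abscissa `c`.
  obtain ⟨q', hq', hq'2⟩ : ∃ q' ∈ Ioc s q, ∀ t ∈ Ico s q', σ * ((γ t).re - c) < 0 :=
    (mem_nhdsGE_iff_exists_mem_Ioc_Ico_subset hsq).1
      (mem_nhdsWithin_of_mem_nhds (hcont.eventually (gt_mem_nhds hcs)))
  have hI : Ioo s q' ⊆ Icc (0 : ℝ) 1 := fun t ht =>
    ⟨hs0.trans ht.1.le, (ht.2.le.trans hq'.2).trans (hqt.le.trans h.mem.2.le)⟩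
  have hae' := ae_restrict_of_ae_restrict_of_subset hI hae
  have hne : (ae (volume.restrict (Ioo s q'))).NeBot := by
    rw [ae_neBot, ne_eq, Measure.restrict_eq_zero, Real.volume_Ioo, ENNReal.ofReal_eq_zero, not_le,
      sub_pos]
    exact hq'.1
  obtain ⟨t, ht, ht1, -⟩ := ((ae_restrict_mem measurableSet_Ioo).and hae').exists
  have ht3 := h3 t ⟨ht.1, ht.2.trans_le hq'.2⟩
  refine ⟨t, ?_, ht3.1, ?_⟩
  -- Below the height of the centre the equality in Cauchy–Schwarz makes `side` positive.
  · by_contra hn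
    have hside : side D γ t ≤ 0 := by
      rw [side, indicator_of_notMem hn, zero_sub, neg_nonpos]
      exact indicator_nonneg (fun _ _ => zero_le_one) _
    have p1 : 0 < speed γ t * (((γ 0).im + (γ t₁).im) / 2 - (γ t).im) :=
      mul_pos (h.curve.speed_pos t) (by linarith [ht3.2])
    rw [← ht1] at p1
    have p2 := mul_nonneg (abs_nonneg (derivRe γ t)) hR.le
    nlinarith
  · have e1 := h1 t ⟨ht.1.le, (ht.2.trans_le hq'.2).le⟩
    have e2 := hq'2 t ⟨ht.1.le, ht.2⟩
    have e3 := halfWidth_nonneg (γ 0).im (γ t₁).im (γ t).im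
    rcases hσ with rfl | rfl
    · exact Icc_subset_uIcc ⟨by linarith, by linarith⟩
    · exact Icc_subset_uIcc' ⟨by linarith, by linarith⟩

theorem exists_flat {s s' u : ℝ} (h : IsNormalized γ t₁) (hs : 0 ≤ s) (hs' : 0 ≤ s')
    (hflat : ∀ t ∈ Icc 0 s, (γ t).im = (γ 0).im)
    (hflat' : ∀ t ∈ Icc 0 s', (reversed γ t).im = (γ 0).im)
    (hu : u ∈ uIcc (γ s).re (reversed γ s').re) :
    ∃ t, (γ t).re = u ∧ (γ t).im = (γ 0).im := by
  have h0 : reversed γ 0 = γ 0 := by rw [reversed, sub_zero, h.one]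
  rcases uIcc_subset_uIcc_union_uIcc (b := (γ 0).re) hu with hu | hu
  · obtain ⟨t, ht, rfl⟩ := intermediate_value_uIcc (a := s) (b := 0)
      (f := fun t => (γ t).re) h.curve.continuous_re.continuousOn hu
    rw [uIcc_of_ge hs] at ht
    exact ⟨t, rfl, hflat t ht⟩
  · rw [← h0] at hu
    obtain ⟨t, ht, rfl⟩ := intermediate_value_uIcc (a := 0) (b := s')
      (f := fun t => (reversed γ t).re) h.reversed.curve.continuous_re.continuousOn hu
    rw [uIcc_of_le hs'] at ht
    exact ⟨1 - t, rfl, hflat' t ht⟩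

theorem lowerTimes_reversed {t : ℝ} (ht : t ∈ lowerTimes D (reversed γ)) :
    1 - t ∈ lowerTimes D γ := ht

/-- In the equality case the curve lies on a circle. -/
theorem mem_circle_of_linearEq (hc : IsCompact D) (hD : IsConvex D) (h : IsNormalized γ t₁)
    (hb : range γ = frontier D) (he : LinearEq D γ t₁) :
    ∃ c, ∀ t, ((γ t).re - c) ^ 2 + ((γ t).im - ((γ 0).im + (γ t₁).im) / 2) ^ 2 =
      (((γ t₁).im - (γ 0).im) / 2) ^ 2 := by
  have hR : 0 < ((γ t₁).im - (γ 0).im) / 2 := by have := h.lt; linarith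
  have h0 : reversed γ 0 = γ 0 := by rw [reversed, sub_zero, h.one]
  have h1 : reversed γ (1 - t₁) = γ t₁ := by rw [reversed, sub_sub_cancel]
  have hmem := h.mem
  have hbr : range (reversed γ) = frontier D := by rw [range_reversed, hb]
  obtain ⟨s, q, σ, τ, hs0, hsq, hqt, hflat, hqM, hσ, hτ, hx1, hx2, hl⟩ :=
    exists_quarters_of_linearEq hc hD h hb he
  obtain ⟨s', q', σ', τ', hs0', hsq', hqt', hflat', hqM', hσ', hτ', hx1', hx2', hl'⟩ :=
    exists_quarters_of_linearEq hc hD h.reversed hbr (he.reversed h)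
  rw [h1] at hx1' hx2' hqM'
  rw [h0] at hflat' hx1' hx2' hqM' hl'
  have hmid := halfWidth_mid h.lt.le
  have E1 := hx1 q ⟨hsq.le, le_rfl⟩
  have E2 := hx2 q ⟨le_rfl, hqt.le⟩
  have E3 := hx1' q' ⟨hsq'.le, le_rfl⟩
  have E4 := hx2' q' ⟨le_rfl, hqt'.le⟩
  rw [hqM, hmid] at E1 E2
  rw [hqM', hmid] at E3 E4
  -- Otherwise the arc would start out above the level bottom: one of its lower boundary points
  -- would lie over a bottom point, although it is the lowest in its slice.
  have F1 : 0 ≤ σ * ((γ s).re - (reversed γ s').re) := by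
    by_contra! hneg
    obtain ⟨t, ht, hlt, hmemt⟩ := hl _ hneg
    obtain ⟨u, hu1, hu2⟩ := exists_flat h hs0 hs0' hflat hflat' hmemt
    exact (im_le_of_mem_lowerTimes hD hb (curve_mem hc.isClosed hb u) ht hu1).not_gt
      (hu2 ▸ hlt)
  have F2 : 0 ≤ σ' * ((reversed γ s').re - (γ s).re) := by
    by_contra! hneg
    obtain ⟨t, ht, hlt, hmemt⟩ := hl' _ hneg
    rw [uIcc_comm] at hmemt
    obtain ⟨u, hu1, hu2⟩ := exists_flat h hs0 hs0' hflat hflat' hmemt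
    exact (im_le_of_mem_lowerTimes hD hb (curve_mem hc.isClosed hb u)
      (lowerTimes_reversed ht) hu1).not_gt (hu2 ▸ hlt)
  -- If σ = σ', then `F1` and `F2` are opposite inequalities. Otherwise E1–E4 bound the difference
  -- from the other side, as τ - τ' is at most 2 in absolute value.
  have G : (γ s).re = (reversed γ s').re := by
    rcases hσ with rfl | rfl <;> rcases hσ' with rfl | rfl <;> rcases hτ with rfl | rfl <;>
      rcases hτ' with rfl | rfl <;> linarith
  have hsS : (γ s).im = (reversed γ s').im := by
    rw [hflat s ⟨hs0, le_rfl⟩, hflat' s' ⟨hs0', le_rfl⟩]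
  have hS : s = 0 ∧ s' = 0 := by
    rcases hs0'.eq_or_lt with hz | hz
    · rw [← hz, h0] at G hsS
      exact ⟨injOn_Ico_of_curve h.curve ⟨hs0, by linarith⟩ ⟨le_rfl, one_pos⟩ G hsS, hz.symm⟩
    · have : s = 1 - s' := injOn_Ico_of_curve h.curve ⟨hs0, by linarith⟩
        ⟨by linarith, by linarith⟩ G hsS
      linarith
  -- The two points at the height of the centre belong to different halves of a simple curve; hence
  -- the signs of the halves are opposite, and bottom and top have the same abscissa.
  have hQ : (γ q).re ≠ (reversed γ q').re := by
    intro hr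
    have : q = 1 - q' := injOn_Ico_of_curve h.curve ⟨by linarith, by linarith⟩
      ⟨by linarith, by linarith⟩ hr (hqM.trans hqM'.symm)
    linarith
  have hσσ : σ ≠ σ' := by
    rintro rfl
    exact hQ (by rw [E1, E3, G])
  have hττ : τ ≠ τ' := by
    rintro rfl
    exact hQ (by rw [E2, E4])
  have hcc : (γ s).re = (γ t₁).re := by
    rcases hσ with rfl | rfl <;> rcases hσ' with rfl | rfl <;> rcases hτ with rfl | rfl <;>
      rcases hτ' with rfl | rfl <;> first | exact absurd rfl hσσ | exact absurd rfl hττ | linarith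
  obtain ⟨rfl, rfl⟩ := hS
  have key : ∀ (z : ℍ) (ρ : ℝ), (γ 0).im ≤ z.im → z.im ≤ (γ t₁).im → (ρ = 1 ∨ ρ = -1) →
      z.re = (γ t₁).re + ρ * halfWidth (γ 0).im (γ t₁).im z.im →
      (z.re - (γ t₁).re) ^ 2 + (z.im - ((γ 0).im + (γ t₁).im) / 2) ^ 2 =
      (((γ t₁).im - (γ 0).im) / 2) ^ 2 := by
    intro z ρ hz1 hz2 hρ hz
    have hρ2 : ρ ^ 2 = 1 := by rcases hρ with e | e <;> rw [e] <;> norm_num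
    rw [hz, add_sub_cancel_left, mul_pow, hρ2, halfWidth_sq hz1 hz2]
    ring
  have key1 : ∀ t ∈ Ico (0 : ℝ) 1, ((γ t).re - (γ t₁).re) ^ 2 +
      ((γ t).im - ((γ 0).im + (γ t₁).im) / 2) ^ 2 = (((γ t₁).im - (γ 0).im) / 2) ^ 2 := by
    intro t ht
    rcases le_total t t₁ with h2 | h2
    · rcases le_total t q with h3 | h3
      · exact key _ σ (h.low t) (h.high t) hσ (hcc ▸ hx1 t ⟨ht.1, h3⟩)
      · exact key _ τ (h.low t) (h.high t) hτ (hx2 t ⟨h3, h2⟩)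
    · have e : γ t = reversed γ (1 - t) := by rw [reversed, sub_sub_cancel]
      have hl := h.low t
      have hh := h.high t
      rw [e] at hl hh ⊢
      rcases le_total (1 - t) q' with h3 | h3
      · refine key _ σ' hl hh hσ' ?_
        rw [← hcc, G]
        exact hx1' (1 - t) ⟨by linarith [ht.2], h3⟩
      · exact key _ τ' hl hh hτ' (hx2' (1 - t) ⟨h3, by linarith⟩)
  refine ⟨(γ t₁).re, fun t => ?_⟩
  obtain ⟨u, hu, e⟩ := h.curve.periodic.exists_mem_Ico₀ one_pos t
  rw [e]
  exact key1 u hu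

end curve

/-! ### Hyperbolic balls as Euclidean disks, and sets bounded by a circle -/

theorem dist_lt_iff_sq {w z : ℍ} {r : ℝ} (hr : 0 < r) : dist w z < r ↔
    (w.re - z.re) ^ 2 + (w.im - z.im * Real.cosh r) ^ 2 < (z.im * Real.sinh r) ^ 2 := by
  have h0 : 0 < z.im * Real.sinh r := mul_pos z.im_pos (Real.sinh_pos_iff.2 hr)
  rw [UpperHalfPlane.dist_lt_iff_dist_coe_center_lt, Complex.dist_eq_re_im, Real.sqrt_lt' h0]
  rfl

theorem lt_dist_iff_sq {w z : ℍ} {r : ℝ} (hr : 0 < r) : r < dist w z ↔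
    (z.im * Real.sinh r) ^ 2 < (w.re - z.re) ^ 2 + (w.im - z.im * Real.cosh r) ^ 2 := by
  have h0 : 0 < z.im * Real.sinh r := mul_pos z.im_pos (Real.sinh_pos_iff.2 hr)
  rw [UpperHalfPlane.lt_dist_iff_lt_dist_coe_center, Complex.dist_eq_re_im, Real.lt_sqrt h0.le]
  rfl

theorem dist_eq_iff_sq {w z : ℍ} {r : ℝ} (hr : 0 < r) : dist w z = r ↔
    (w.re - z.re) ^ 2 + (w.im - z.im * Real.cosh r) ^ 2 = (z.im * Real.sinh r) ^ 2 := by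
  have h1 := dist_lt_iff_sq (w := w) (z := z) hr
  have h2 := lt_dist_iff_sq (w := w) (z := z) hr
  constructor
  · intro h
    exact le_antisymm (not_lt.1 fun h' => (h2.2 h').ne' h) (not_lt.1 fun h' => (h1.2 h').ne h)
  · intro h
    exact le_antisymm (not_lt.1 fun h' => (h2.1 h').ne' h) (not_lt.1 fun h' => (h1.1 h').ne h)

theorem isPreconnected_ball (z : ℍ) (r : ℝ) : IsPreconnected (Metric.ball z r) := by
  rw [← UpperHalfPlane.isOpenEmbedding_coe.isInducing.isPreconnected_image,
    UpperHalfPlane.image_coe_ball]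
  exact (convex_ball _ _).isPreconnected

theorem closedBall_subset_closure_ball (z : ℍ) {r : ℝ} (hr : 0 < r) :
    Metric.closedBall z r ⊆ closure (Metric.ball z r) := by
  rw [UpperHalfPlane.isOpenEmbedding_coe.isInducing.closure_eq_preimage_closure_image,
    UpperHalfPlane.image_coe_ball,
    closure_ball _ (mul_pos z.im_pos (Real.sinh_pos_iff.2 hr)).ne',
    ← UpperHalfPlane.image_coe_closedBall]
  exact subset_preimage_image _ _

/-- A preconnected set that meets `D` but not its boundary lies in `D`. -/
theorem subset_of_isPreconnected {D P : Set ℍ} (hcl : IsClosed D) (hP : IsPreconnected P)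
    (hf : ∀ w ∈ P, w ∉ frontier D) (hne : (P ∩ D).Nonempty) : P ⊆ D := by
  have hint : ∀ w ∈ P, w ∈ D → w ∈ interior D := fun w hw hwD => by
    by_contra h
    exact hf w hw ⟨subset_closure hwD, h⟩
  refine (hP.subset_left_of_subset_union isOpen_interior hcl.isOpen_compl
    (disjoint_compl_right.mono_left interior_subset) (fun w hw => ?_) ?_).trans interior_subset
  · by_cases h : w ∈ D
    · exact Or.inl (hint w hw h)
    · exact Or.inr h
  · obtain ⟨w, hw, hwD⟩ := hne
    exact ⟨w, hw, hint w hw hwD⟩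

/-- A compact set with interior whose boundary lies on a circle is the disk of that circle. -/
theorem eq_closedBall_of_frontier_subset {D : Set ℍ} (hc : IsCompact D)
    (hne : (interior D).Nonempty) {z : ℍ} {r : ℝ} (hr : 0 < r)
    (hf : ∀ w ∈ frontier D, dist w z = r) : D = Metric.closedBall z r := by
  apply subset_antisymm
  · intro w hw
    rw [Metric.mem_closedBall]
    by_contra! hlt
    -- From a point of `D` outside the circle, the horizontal ray pointing away from the axis of the
    -- circle never meets it. The ray therefore stays in `D`, against compactness.
    obtain ⟨ε, hε, hεw⟩ : ∃ ε : ℝ, (ε = 1 ∨ ε = -1) ∧ 0 ≤ ε * (w.re - z.re) := by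
      rcases le_total 0 (w.re - z.re) with h | h
      · exact ⟨1, Or.inl rfl, by linarith⟩
      · exact ⟨-1, Or.inr rfl, by linarith⟩
    have hε2 : ε ^ 2 = 1 := by rcases hε with e | e <;> rw [e] <;> norm_num
    let ray : ℝ → ℍ := fun s => ⟨⟨w.re + ε * s, w.im⟩, w.im_pos⟩
    have hray : Continuous ray := by
      rw [UpperHalfPlane.isOpenEmbedding_coe.isInducing.continuous_iff]
      have : (UpperHalfPlane.coe ∘ ray) =
          fun s : ℝ => ((w.re + ε * s : ℝ) : ℂ) + (w.im : ℂ) * Complex.I := by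
        ext s; simp [ray, Complex.mk_eq_add_mul_I]
      rw [this]
      fun_prop
    have hsub : ray '' Ici 0 ⊆ D := by
      refine subset_of_isPreconnected hc.isClosed (isPreconnected_Ici.image _ hray.continuousOn) ?_
        ⟨w, ⟨0, self_mem_Ici, ?_⟩, hw⟩
      · rintro _ ⟨s, hs, rfl⟩ hfr
        have h1 := (dist_eq_iff_sq hr).1 (hf _ hfr)
        have h2 := (lt_dist_iff_sq hr).1 hlt
        simp only [ray, UpperHalfPlane.mk_re, UpperHalfPlane.mk_im] at h1
        have h3 : 0 ≤ s * (ε * (w.re - z.re)) := mul_nonneg hs hεw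
        nlinarith [sq_nonneg s]
      · exact UpperHalfPlane.ext_re_im (by simp [ray]) rfl
    obtain ⟨B, hB⟩ := (hc.image UpperHalfPlane.continuous_re).isBounded.exists_norm_le
    have hs0 : 0 ≤ B + |w.re| + 1 := by
      have := (norm_nonneg _).trans (hB _ ⟨w, hw, rfl⟩)
      positivity
    have h1 := hB _ ⟨_, hsub ⟨B + |w.re| + 1, hs0, rfl⟩, rfl⟩
    simp only [ray, UpperHalfPlane.mk_re, Real.norm_eq_abs] at h1
    have h2 := abs_le.1 h1
    have h3 := abs_le.1 (le_refl |w.re|)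
    rcases hε with rfl | rfl <;> linarith
  · refine (closedBall_subset_closure_ball z hr).trans
      (hc.isClosed.closure_subset_iff.2 (subset_of_isPreconnected hc.isClosed
        (isPreconnected_ball z r) (fun w hw hfr => (Metric.mem_ball.1 hw).ne (hf w hfr)) ?_))
    obtain ⟨q, hq⟩ := hne
    refine ⟨q, ?_, interior_subset hq⟩
    -- An interior point lies between two frontier points on its vertical line; these are symmetric
    -- about the height of the Euclidean centre, so the interior point is inside the circle.
    obtain ⟨p₁, hp₁, hr₁, hi₁⟩ := exists_lowest hc hq
    obtain ⟨p₂, hp₂, hr₂, hi₂⟩ := exists_highest hc hq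
    have h1 := (dist_eq_iff_sq hr).1 (hf _ hp₁)
    have h2 := (dist_eq_iff_sq hr).1 (hf _ hp₂)
    rw [hr₁] at h1
    rw [hr₂] at h2
    rw [Metric.mem_ball, dist_lt_iff_sq hr]
    have h3 : (p₂.im - p₁.im) * (p₁.im + p₂.im - 2 * (z.im * Real.cosh r)) = 0 := by
      linear_combination h2 - h1
    have h4 : p₁.im + p₂.im - 2 * (z.im * Real.cosh r) = 0 :=
      (mul_eq_zero.1 h3).resolve_left (by linarith)
    nlinarith [mul_pos (sub_pos.2 hi₁) (sub_pos.2 hi₂)]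

section curve

variable {D : Set ℍ} {γ : ℝ → ℍ} {a b t₁ : ℝ}

/-- A hyperbolic circle of radius r centred at height g has extreme heights g·exp(-r) and g·exp(r);
hence g = √(ab) and g·sinh r = (b-a)/2. -/
theorem isDisk_of_linearEq (hc : IsCompact D) (hne : (interior D).Nonempty) (hD : IsConvex D)
    (h : IsNormalized γ t₁) (hb : range γ = frontier D) (he : LinearEq D γ t₁) : IsDisk D := by
  obtain ⟨c, hcirc⟩ := mem_circle_of_linearEq hc hD h hb he
  have ha := (γ 0).im_pos
  have hab := h.lt
  set a := (γ 0).im with ha'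
  set b := (γ t₁).im with hb'
  have hp : 0 < a * b := mul_pos ha (ha.trans hab)
  have hg : 0 < √(a * b) := Real.sqrt_pos.2 hp
  have hg2 : √(a * b) ^ 2 = a * b := Real.sq_sqrt hp.le
  have hR : 0 < (b - a) / 2 := by linarith
  set r := Real.arsinh ((b - a) / 2 / √(a * b)) with hr
  have hr0 : 0 < r := Real.arsinh_pos_iff.2 (div_pos hR hg)
  have hsinh : √(a * b) * Real.sinh r = (b - a) / 2 := by
    rw [hr, Real.sinh_arsinh]; field_simp
  have hcosh : √(a * b) * Real.cosh r = (a + b) / 2 := by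
    refine (pow_left_inj₀ (mul_nonneg hg.le (Real.cosh_pos r).le) (by linarith) two_ne_zero).1 ?_
    rw [mul_pow, Real.cosh_sq, mul_add, ← mul_pow, hsinh, mul_one, hg2]; ring
  refine ⟨⟨⟨c, √(a * b)⟩, hg⟩, r, hr0, eq_closedBall_of_frontier_subset hc hne hr0 fun w hw => ?_⟩
  rw [← hb] at hw
  obtain ⟨t, rfl⟩ := hw
  rw [dist_eq_iff_sq hr0]
  simp only [UpperHalfPlane.mk_re, UpperHalfPlane.mk_im]
  rw [hsinh, hcosh]
  exact hcirc t

/-! ### Disks attain equality -/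

/-- The curve lies on the circle with centre on the line `re = c` over its range of heights. -/
def OnCircle (γ : ℝ → ℍ) (t₁ c : ℝ) : Prop :=
  ∀ t, ((γ t).re - c) ^ 2 + ((γ t).im - ((γ 0).im + (γ t₁).im) / 2) ^ 2 =
      (((γ t₁).im - (γ 0).im) / 2) ^ 2

/-- The velocity is orthogonal to the Euclidean radius. -/
theorem OnCircle.speed_eq {c : ℝ} (h : IsNormalized γ t₁) (ho : OnCircle γ t₁ c) (t : ℝ) :
    |derivIm γ t| * (((γ t₁).im - (γ 0).im) / 2) =
        speed γ t * halfWidth (γ 0).im (γ t₁).im (γ t).im ∧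
      |derivRe γ t| * (((γ t₁).im - (γ 0).im) / 2) =
        speed γ t * |((γ 0).im + (γ t₁).im) / 2 - (γ t).im| := by
  have hR : 0 < ((γ t₁).im - (γ 0).im) / 2 := by have := h.lt; linarith
  have htan : ((γ t).re - c) * derivRe γ t +
      ((γ t).im - ((γ 0).im + (γ t₁).im) / 2) * derivIm γ t = 0 := by
    have h1 := (((h.curve.hasDerivAt_re t).sub_const c).fun_pow 2).fun_add
      (((h.curve.hasDerivAt_im t).sub_const (((γ 0).im + (γ t₁).im) / 2)).fun_pow 2)
    have h2 : (fun t => ((γ t).re - c) ^ 2 + ((γ t).im - ((γ 0).im + (γ t₁).im) / 2) ^ 2) =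
      fun _ => (((γ t₁).im - (γ 0).im) / 2) ^ 2 := funext ho
    rw [h2] at h1
    have h3 := h1.unique (hasDerivAt_const t _)
    simp only [Nat.cast_ofNat, Nat.add_one_sub_one, pow_one] at h3
    linarith
  have hX := halfWidth_sq (h.low t) (h.high t)
  have hs := speed_sq γ t
  have ho := ho t
  set X := halfWidth (γ 0).im (γ t₁).im (γ t).im with hXdef
  have hX0 : 0 ≤ X := halfWidth_nonneg _ _ _
  have hv := h.curve.speed_pos t
  constructor
  · refine (pow_left_inj₀ (by positivity) (by positivity) two_ne_zero).1 ?_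
    rw [mul_pow, mul_pow, sq_abs, hX, hs]
    linear_combination (derivRe γ t ^ 2) * ho -
      (((γ t).re - c) * derivRe γ t - ((γ t).im - ((γ 0).im + (γ t₁).im) / 2) * derivIm γ t) * htan
  · refine (pow_left_inj₀ (by positivity) (by positivity) two_ne_zero).1 ?_
    rw [mul_pow, mul_pow, sq_abs, sq_abs, hs]
    linear_combination (-derivRe γ t ^ 2) * ho +
      (((γ t).re - c) * derivRe γ t - ((γ t).im - ((γ 0).im + (γ t₁).im) / 2) * derivIm γ t) * htan

/-- Along the rising half the Euclidean angle times R, and the hyperbolic angle times R/g, are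
antiderivatives of the Euclidean and hyperbolic speeds; each angle grows by π. -/
theorem OnCircle.integral_half {c : ℝ} (h : IsNormalized γ t₁) (ho : OnCircle γ t₁ c) :
    ∫ t in (0 : ℝ)..t₁, speed γ t = ((γ t₁).im - (γ 0).im) / 2 * Real.pi ∧
    ∫ t in (0 : ℝ)..t₁, speed γ t / (γ t).im =
      ((γ t₁).im - (γ 0).im) / 2 * Real.pi / √((γ 0).im * (γ t₁).im) := by
  have hR : 0 < ((γ t₁).im - (γ 0).im) / 2 := by have := h.lt; linarith
  have ha := (γ 0).im_pos
  have hp : 0 < (γ 0).im * (γ t₁).im := mul_pos ha (γ t₁).im_pos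
  have hg : 0 < √((γ 0).im * (γ t₁).im) := Real.sqrt_pos.2 hp
  have hre : ∀ t, ((γ t).im = (γ 0).im ∨ (γ t).im = (γ t₁).im) → (γ t).re = c := by
    intro t ht
    have h1 := ho t
    have h2 : ((γ t).re - c) ^ 2 = 0 := by
      rcases ht with e | e <;> rw [e] at h1 <;> linear_combination h1
    exact sub_eq_zero.1 (pow_eq_zero_iff two_ne_zero |>.1 h2)
  have hI : ∀ t ∈ Ioo 0 t₁, (γ 0).im < (γ t).im ∧ (γ t).im < (γ t₁).im := by
    intro t ht
    have ht' : t ∈ Ico (0 : ℝ) 1 := ⟨ht.1.le, ht.2.trans h.mem.2⟩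
    refine ⟨lt_of_le_of_ne (h.low t) fun e => ?_, lt_of_le_of_ne (h.high t) fun e => ?_⟩
    · exact ht.1.ne (injOn_Ico_of_curve h.curve ⟨le_rfl, one_pos⟩ ht'
        ((hre 0 (Or.inl rfl)).trans (hre t (Or.inl e.symm)).symm) e)
    · exact ht.2.ne (injOn_Ico_of_curve h.curve ht' ⟨h.mem.1.le, h.mem.2⟩
        ((hre t (Or.inr e)).trans (hre t₁ (Or.inr rfl)).symm) e)
  have hX0 : ∀ t ∈ Ioo 0 t₁, 0 < halfWidth (γ 0).im (γ t₁).im (γ t).im := fun t ht =>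
    halfWidth_pos (hI t ht).1 (hI t ht).2
  -- Bottom and top of the circle are visited only at the ends, so y' has no zero in between; were
  -- it negative, the height could not rise.
  have hpos : ∀ t ∈ Ioo 0 t₁, 0 < derivIm γ t := by
    refine (pos_or_neg_of_ne_zero h.curve.continuous_derivIm fun t ht e => ?_).resolve_right
      fun hneg => ?_
    · have h1 := (ho.speed_eq h t).1
      rw [e, abs_zero, zero_mul] at h1
      exact (mul_pos (h.curve.speed_pos t) (hX0 t ht)).ne h1
    · have hanti : AntitoneOn (fun t => (γ t).im) (Icc 0 t₁) :=
        antitoneOn_of_deriv_nonpos (convex_Icc 0 t₁) h.curve.continuous_im.continuousOn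
        (fun t _ => (h.curve.hasDerivAt_im t).differentiableAt.differentiableWithinAt) fun t ht => by
          rw [interior_Icc] at ht
          rw [(h.curve.hasDerivAt_im t).deriv]
          exact (hneg t ht).le
      exact (hanti ⟨le_rfl, h.mem.1.le⟩ ⟨h.mem.1.le, le_rfl⟩ h.mem.1.le).not_gt h.lt
  have hd : ∀ t ∈ Ioo 0 t₁, derivIm γ t =
      speed γ t * halfWidth (γ 0).im (γ t₁).im (γ t).im / (((γ t₁).im - (γ 0).im) / 2) := by
    intro t ht
    rw [eq_div_iff hR.ne', ← (ho.speed_eq h t).1, abs_of_pos (hpos t ht)]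
  constructor
  · rw [intervalIntegral.integral_eq_sub_of_hasDerivAt_of_le h.mem.1.le
      (f := fun t => ((γ t₁).im - (γ 0).im) / 2 * euclAngle (γ 0).im (γ t₁).im (γ t).im)]
    · rw [euclAngle_left h.lt, euclAngle_right h.lt]; ring
    · exact (continuous_const.mul
        ((continuous_euclAngle _ _).comp h.curve.continuous_im)).continuousOn
    · intro t ht
      refine (((hasDerivAt_euclAngle (hI t ht).1 (hI t ht).2).comp t
        (h.curve.hasDerivAt_im t)).const_mul (((γ t₁).im - (γ 0).im) / 2)).congr_deriv ?_
      rw [hd t ht]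
      have := (hX0 t ht).ne'
      have : (γ t₁).im - (γ 0).im ≠ 0 := by linarith
      field_simp
    · exact h.curve.continuous_speed.intervalIntegrable _ _
  · rw [intervalIntegral.integral_eq_sub_of_hasDerivAt_of_le h.mem.1.le
      (f := fun t => ((γ t₁).im - (γ 0).im) / 2 / √((γ 0).im * (γ t₁).im) *
        hypAngle (γ 0).im (γ t₁).im (γ t).im)]
    · rw [hypAngle_left ha h.lt, hypAngle_right ha h.lt]; ring
    · exact continuousOn_const.mul ((continuousOn_hypAngle ha h.lt).comp
        h.curve.continuous_im.continuousOn fun t _ => ⟨h.low t, h.high t⟩)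
    · intro t ht
      refine (((hasDerivAt_hypAngle ha (hI t ht).1 (hI t ht).2).comp t
        (h.curve.hasDerivAt_im t)).const_mul
          (((γ t₁).im - (γ 0).im) / 2 / √((γ 0).im * (γ t₁).im))).congr_deriv ?_
      rw [hd t ht]
      have := (hX0 t ht).ne'
      have : (γ t₁).im - (γ 0).im ≠ 0 := by linarith
      have := (γ t).im_ne_zero
      field_simp
    · exact (h.curve.continuous_speed.div h.curve.continuous_im
        fun t => (γ t).im_ne_zero).intervalIntegrable _ _

theorem OnCircle.reversed {c : ℝ} (h : IsNormalized γ t₁) (ho : OnCircle γ t₁ c) :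
    OnCircle (reversed γ) (1 - t₁) c := by
  have h0 : HypIso.reversed γ 0 = γ 0 := by rw [HypIso.reversed, sub_zero, h.one]
  have h1 : HypIso.reversed γ (1 - t₁) = γ t₁ := by rw [HypIso.reversed, sub_sub_cancel]
  intro t
  rw [h0, h1]
  exact ho (1 - t)

theorem speed_reversed (γ : ℝ → ℍ) (t : ℝ) : speed (reversed γ) t = speed γ (1 - t) := by
  rw [speed, speed, deriv_reversed, norm_neg]

theorem OnCircle.integral_full {c : ℝ} (h : IsNormalized γ t₁) (ho : OnCircle γ t₁ c) :
    ∫ t in (0 : ℝ)..1, speed γ t = 2 * (((γ t₁).im - (γ 0).im) / 2 * Real.pi) ∧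
    curveLength γ =
      2 * (((γ t₁).im - (γ 0).im) / 2 * Real.pi / √((γ 0).im * (γ t₁).im)) := by
  have h0 : HypIso.reversed γ 0 = γ 0 := by rw [HypIso.reversed, sub_zero, h.one]
  have h1 : HypIso.reversed γ (1 - t₁) = γ t₁ := by rw [HypIso.reversed, sub_sub_cancel]
  obtain ⟨e1, e2⟩ := ho.integral_half h
  obtain ⟨e3, e4⟩ := (ho.reversed h).integral_half h.reversed
  rw [h0, h1] at e3 e4
  simp only [speed_reversed] at e3 e4
  have c1 : Continuous fun t => speed γ t / (γ t).im :=
    h.curve.continuous_speed.div h.curve.continuous_im fun t => (γ t).im_ne_zero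
  have s1 := intervalIntegral.integral_comp_sub_left (a := 0) (b := 1 - t₁) (speed γ) 1
  have s2 := intervalIntegral.integral_comp_sub_left (a := 0) (b := 1 - t₁)
    (fun t => speed γ t / (γ t).im) 1
  rw [sub_zero, sub_sub_cancel] at s1 s2
  change ∫ t in (0 : ℝ)..(1 - t₁), speed γ (1 - t) / (γ (1 - t)).im = _ at e4
  constructor
  · rw [← intervalIntegral.integral_add_adjacent_intervals (b := t₁)
      (h.curve.continuous_speed.intervalIntegrable _ _)
      (h.curve.continuous_speed.intervalIntegrable _ _), e1, ← s1, e3]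
    ring
  · change ∫ t in (0 : ℝ)..1, speed γ t / (γ t).im = _
    rw [← intervalIntegral.integral_add_adjacent_intervals (b := t₁)
      (c1.intervalIntegrable _ _) (c1.intervalIntegrable _ _), e2, ← s2, e4]
    ring

/-- Off the height of the centre, the point at that height on the same vertical line is interior,
and so decides between lower and upper boundary. -/
theorem OnCircle.side_mul {c : ℝ} (hD : IsConvex D) (hb : range γ = frontier D)
    (h : IsNormalized γ t₁) (ho : OnCircle γ t₁ c)
    (hin : ∀ w : ℍ, (w.re - c) ^ 2 + (w.im - ((γ 0).im + (γ t₁).im) / 2) ^ 2 <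
      (((γ t₁).im - (γ 0).im) / 2) ^ 2 → w ∈ interior D) (t : ℝ) :
    side D γ t * |derivRe γ t| * (((γ t₁).im - (γ 0).im) / 2) =
      speed γ t * (((γ 0).im + (γ t₁).im) / 2 - (γ t).im) := by
  have hR : 0 < ((γ t₁).im - (γ 0).im) / 2 := by have := h.lt; linarith
  have hM : 0 < ((γ 0).im + (γ t₁).im) / 2 := by
    have := (γ 0).im_pos
    have := (γ t₁).im_pos
    positivity
  have h1 := (ho.speed_eq h t).2
  have hcirc := ho t
  have hmem : (γ t).im ≠ ((γ 0).im + (γ t₁).im) / 2 →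
      (⟨⟨(γ t).re, ((γ 0).im + (γ t₁).im) / 2⟩, hM⟩ : ℍ) ∈ interior D := by
    intro hne
    apply hin
    simp only [UpperHalfPlane.mk_re, UpperHalfPlane.mk_im]
    have : 0 < ((γ t).im - ((γ 0).im + (γ t₁).im) / 2) ^ 2 := by
      have := sub_ne_zero.2 hne
      positivity
    linarith
  have hdis := Set.disjoint_left.1 (disjoint_lower_upper hD hb)
  rcases lt_trichotomy (γ t).im (((γ 0).im + (γ t₁).im) / 2) with hlt | heq | hlt
  · have hl : t ∈ lowerTimes D γ := ⟨_, hmem hlt.ne, rfl, hlt⟩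
    have hs : side D γ t = 1 := by simp [side, hl, hdis hl]
    rw [abs_of_pos (sub_pos.2 hlt)] at h1
    rw [hs, one_mul, h1]
  · rw [heq, sub_self, abs_zero, mul_zero, mul_eq_zero, or_iff_left hR.ne'] at h1
    rw [heq, h1]
    ring
  · have hu : t ∈ upperTimes D γ := ⟨_, hmem hlt.ne', rfl, hlt⟩
    have hnl : t ∉ lowerTimes D γ := fun hl => hdis hl hu
    have hs : side D γ t = -1 := by simp [side, hu, hnl]
    rw [abs_of_neg (sub_neg.2 hlt)] at h1
    rw [hs]
    linear_combination -h1

/-- A disk realizes equality. -/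
theorem OnCircle.sq_eq {c : ℝ} (hc : IsCompact D) (hD : IsConvex D) (hb : range γ = frontier D)
    (h : IsNormalized γ t₁) (ho : OnCircle γ t₁ c)
    (hin : ∀ w : ℍ, (w.re - c) ^ 2 + (w.im - ((γ 0).im + (γ t₁).im) / 2) ^ 2 <
      (((γ t₁).im - (γ 0).im) / 2) ^ 2 → w ∈ interior D) :
    curveLength γ ^ 2 = 4 * Real.pi * area D + area D ^ 2 := by
  obtain ⟨e1, e2⟩ := ho.integral_full h
  -- Divide `side_mul` by y and integrate: RA = ML minus the Euclidean length.
  have hA : ((γ t₁).im - (γ 0).im) / 2 * area D =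
      ((γ 0).im + (γ t₁).im) / 2 * curveLength γ - ∫ t in (0 : ℝ)..1, speed γ t := by
    have c1 : Continuous fun t => speed γ t / (γ t).im :=
      h.curve.continuous_speed.div h.curve.continuous_im fun t => (γ t).im_ne_zero
    have c2 : Continuous fun t => ((γ 0).im + (γ t₁).im) / 2 * (speed γ t / (γ t).im) :=
      continuous_const.mul c1
    change _ = _ * (∫ t in (0 : ℝ)..1, speed γ t / (γ t).im) - _
    rw [area_eq_integral hc hD h.curve hb, ← intervalIntegral.integral_const_mul,
      ← intervalIntegral.integral_const_mul, ← intervalIntegral.integral_sub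
      (c2.intervalIntegrable _ _)
      (h.curve.continuous_speed.intervalIntegrable _ _)]
    refine intervalIntegral.integral_congr fun t _ => ?_
    have h0 := (γ t).im_ne_zero
    have := ho.side_mul hD hb h hin t
    field_simp
    linear_combination 2 * this
  have hab := h.lt
  have hp : 0 < (γ 0).im * (γ t₁).im := mul_pos (γ 0).im_pos (γ t₁).im_pos
  have hg : 0 < √((γ 0).im * (γ t₁).im) := Real.sqrt_pos.2 hp
  have hg2 : √((γ 0).im * (γ t₁).im) ^ 2 = (γ 0).im * (γ t₁).im := Real.sq_sqrt hp.le
  rw [e1] at hA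
  set g := √((γ 0).im * (γ t₁).im)
  set R := ((γ t₁).im - (γ 0).im) / 2 with hRdef
  set M := ((γ 0).im + (γ t₁).im) / 2 with hMdef
  have hR : 0 < R := by rw [hRdef]; linarith
  have hgM : g ^ 2 = M ^ 2 - R ^ 2 := by rw [hg2, hRdef, hMdef]; ring
  have hA' : area D = 2 * Real.pi * (M - g) / g := by
    apply mul_left_cancel₀ hR.ne'
    rw [hA, e2]
    field_simp
  rw [e2, hA']
  field_simp
  linear_combination 2 * hgM

/-! ### Change of base point and conclusion -/

/-- Change of base point of a closed curve. -/
def shifted (γ : ℝ → ℍ) (c t : ℝ) : ℍ := γ (t + c)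

theorem deriv_shifted (γ : ℝ → ℍ) (c t : ℝ) :
    deriv (fun s => (shifted γ c s : ℂ)) t = deriv (fun s => (γ s : ℂ)) (t + c) :=
  deriv_comp_add_const (f := fun s => (γ s : ℂ)) c t

theorem range_shifted (γ : ℝ → ℍ) (c : ℝ) : range (shifted γ c) = range γ :=
  (Equiv.addRight c).surjective.range_comp γ

theorem IsSimpleClosedC1Curve.periodic_deriv (hγ : IsSimpleClosedC1Curve γ) :
    Function.Periodic (deriv (fun s => (γ s : ℂ))) 1 := by
  intro t
  rw [← deriv_shifted]
  congr 1
  ext s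
  exact congrArg _ (hγ.periodic s)

theorem IsSimpleClosedC1Curve.eq_fract (hγ : IsSimpleClosedC1Curve γ) (t : ℝ) :
    γ (Int.fract t) = γ t := by
  have := hγ.periodic.sub_zsmul_eq (x := t) ⌊t⌋
  rwa [zsmul_one] at this

theorem IsSimpleClosedC1Curve.shifted (hγ : IsSimpleClosedC1Curve γ) (c : ℝ) :
    IsSimpleClosedC1Curve (shifted γ c) where
  contDiff := hγ.contDiff.comp (contDiff_id.add contDiff_const)
  deriv_ne_zero t := by rw [deriv_shifted]; exact hγ.deriv_ne_zero _
  periodic t := by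
    have := hγ.periodic (t + c)
    rwa [show t + c + 1 = t + 1 + c by ring] at this
  injOn s hs t ht h := by
    have h1 : γ (s + c) = γ (t + c) := h
    rw [← hγ.eq_fract (s + c), ← hγ.eq_fract (t + c)] at h1
    obtain ⟨n, hn⟩ := Int.fract_eq_fract.1 (hγ.injOn ⟨Int.fract_nonneg _, Int.fract_lt_one _⟩
      ⟨Int.fract_nonneg _, Int.fract_lt_one _⟩ h1)
    have h2 : (n : ℝ) < 1 := by linarith [hs.2, ht.1]
    have h3 : (-1 : ℝ) < n := by linarith [hs.1, ht.2]
    have h4 : n = 0 := by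
      have h5 : n < 1 := by exact_mod_cast h2
      have h6 : -1 < n := by exact_mod_cast h3
      omega
    rw [h4, Int.cast_zero] at hn
    linarith

theorem curveLength_shifted (hγ : IsSimpleClosedC1Curve γ) (c : ℝ) :
    curveLength (shifted γ c) = curveLength γ := by
  have hper : Function.Periodic (fun t => ‖deriv (fun s => (γ s : ℂ)) t‖ / (γ t).im) 1 := by
    intro t
    simp only [hγ.periodic_deriv t, hγ.periodic t]
  have h1 := intervalIntegral.integral_comp_add_right (a := 0) (b := 1)
    (fun t => ‖deriv (fun s => (γ s : ℂ)) t‖ / (γ t).im) c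
  have h2 := hper.intervalIntegral_add_eq c 0
  rw [zero_add] at h1 h2
  rw [curveLength, curveLength, ← h2, add_comm c, ← h1]
  refine intervalIntegral.integral_congr fun t _ => ?_
  simp only [deriv_shifted]
  rfl

theorem exists_normalized (hc : IsCompact D) (hne : (interior D).Nonempty)
    (hγ : IsSimpleClosedC1Curve γ) (hb : range γ = frontier D) :
    ∃ c t₁, IsNormalized (shifted γ c) t₁ := by
  obtain ⟨q, hq⟩ := hne
  obtain ⟨p₁, hp₁, -, hi₁⟩ := exists_lowest hc hq
  obtain ⟨p₂, hp₂, -, hi₂⟩ := exists_highest hc hq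
  obtain ⟨c, -, hmin⟩ := isCompact_Icc.exists_isMinOn (nonempty_Icc.2 zero_le_one)
    (hγ.continuous_im.continuousOn (s := Icc (0 : ℝ) 1))
  have hlow : ∀ t, (γ c).im ≤ (γ t).im := fun t => by
    rw [← hγ.eq_fract t]
    exact hmin ⟨Int.fract_nonneg _, (Int.fract_lt_one _).le⟩
  have hs := hγ.shifted c
  obtain ⟨t₁, ht₁, hmax⟩ := isCompact_Icc.exists_isMaxOn (nonempty_Icc.2 zero_le_one)
    (hs.continuous_im.continuousOn (s := Icc (0 : ℝ) 1))
  have hhigh : ∀ t, (shifted γ c t).im ≤ (shifted γ c t₁).im := fun t => by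
    rw [← hs.eq_fract t]
    exact hmax ⟨Int.fract_nonneg _, (Int.fract_lt_one _).le⟩
  have h0 : shifted γ c 0 = γ c := by rw [shifted, zero_add]
  have h1 : shifted γ c 1 = γ c := by
    have := hs.periodic 0
    rwa [zero_add, h0] at this
  have hlt : (shifted γ c 0).im < (shifted γ c t₁).im := by
    rw [h0]
    rw [← hb] at hp₁
    rw [← hb, ← range_shifted γ c] at hp₂
    obtain ⟨u, rfl⟩ := hp₁
    obtain ⟨v, rfl⟩ := hp₂
    linarith [hlow u, hhigh v]
  refine ⟨c, t₁, hs, ⟨lt_of_le_of_ne ht₁.1 fun e => ?_, lt_of_le_of_ne ht₁.2 fun e => ?_⟩,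
    fun t => h0 ▸ hlow _, hhigh, hlt⟩
  · rw [← e] at hlt
    exact lt_irrefl _ hlt
  · rw [e, h0, h1] at hlt
    exact lt_irrefl _ hlt

theorem sq_eq_of_isDisk (hc : IsCompact D) (hD : IsConvex D) (h : IsNormalized γ t₁)
    (hb : range γ = frontier D) (hdisk : IsDisk D) :
    curveLength γ ^ 2 = 4 * Real.pi * area D + area D ^ 2 := by
  obtain ⟨z, r, hr, rfl⟩ := hdisk
  have hS : 0 < z.im * Real.sinh r := mul_pos z.im_pos (Real.sinh_pos_iff.2 hr)
  have hC : 0 < z.im * Real.cosh r := mul_pos z.im_pos (Real.cosh_pos r)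
  have hball : Metric.ball z r ⊆ interior (Metric.closedBall z r) := Metric.ball_subset_interior_closedBall
  have hcirc : ∀ p ∈ frontier (Metric.closedBall z r),
      (p.re - z.re) ^ 2 + (p.im - z.im * Real.cosh r) ^ 2 = (z.im * Real.sinh r) ^ 2 := fun p hp =>
    (dist_eq_iff_sq hr).1 (Metric.mem_sphere.1 (Metric.frontier_closedBall_subset_sphere hp))
  -- The vertical line through the Euclidean centre meets the frontier at centre height ± radius, so
  -- the curve attains the extreme heights of the circle.
  have hq : (⟨⟨z.re, z.im * Real.cosh r⟩, hC⟩ : ℍ) ∈ interior (Metric.closedBall z r) := by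
    refine hball (Metric.mem_ball.2 ((dist_lt_iff_sq hr).2 ?_))
    simp only [UpperHalfPlane.mk_re, UpperHalfPlane.mk_im, sub_self]
    linarith [pow_pos hS 2]
  obtain ⟨p₁, hp₁, hr₁, hi₁⟩ := exists_lowest hc hq
  obtain ⟨p₂, hp₂, hr₂, hi₂⟩ := exists_highest hc hq
  have k₁ := hcirc _ hp₁
  have k₂ := hcirc _ hp₂
  simp only [UpperHalfPlane.mk_re, UpperHalfPlane.mk_im] at hr₁ hr₂ hi₁ hi₂
  rw [hr₁, sub_self] at k₁
  rw [hr₂, sub_self] at k₂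
  have hγc : ∀ t, ((γ t).re - z.re) ^ 2 + ((γ t).im - z.im * Real.cosh r) ^ 2 =
      (z.im * Real.sinh r) ^ 2 := fun t => hcirc _ (hb ▸ mem_range_self t)
  have l₁ : p₁.im = z.im * Real.cosh r - z.im * Real.sinh r := by
    have : (p₁.im - z.im * Real.cosh r) ^ 2 = (z.im * Real.sinh r) ^ 2 := by linarith
    rcases sq_eq_sq_iff_eq_or_eq_neg.1 this with e | e <;> linarith
  have l₂ : p₂.im = z.im * Real.cosh r + z.im * Real.sinh r := by
    have : (p₂.im - z.im * Real.cosh r) ^ 2 = (z.im * Real.sinh r) ^ 2 := by linarith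
    rcases sq_eq_sq_iff_eq_or_eq_neg.1 this with e | e <;> linarith
  have hbound : ∀ t, |(γ t).im - z.im * Real.cosh r| ≤ z.im * Real.sinh r := fun t =>
    abs_le_of_sq_le_sq (by linarith [hγc t, sq_nonneg ((γ t).re - z.re)]) hS.le
  have m₁ : (γ 0).im = z.im * Real.cosh r - z.im * Real.sinh r := by
    rw [← hb] at hp₁
    obtain ⟨u, rfl⟩ := hp₁
    linarith [h.low u, (abs_le.1 (hbound 0)).1]
  have m₂ : (γ t₁).im = z.im * Real.cosh r + z.im * Real.sinh r := by
    rw [← hb] at hp₂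
    obtain ⟨u, rfl⟩ := hp₂
    linarith [h.high u, (abs_le.1 (hbound t₁)).2]
  have hM : ((γ 0).im + (γ t₁).im) / 2 = z.im * Real.cosh r := by rw [m₁, m₂]; ring
  have hR : ((γ t₁).im - (γ 0).im) / 2 = z.im * Real.sinh r := by rw [m₁, m₂]; ring
  refine OnCircle.sq_eq (c := z.re) hc hD hb h (fun t => ?_) fun w hw => ?_
  · rw [hM, hR]; exact hγc t
  · rw [hM, hR] at hw
    exact hball (Metric.mem_ball.2 ((dist_lt_iff_sq hr).2 hw))

end curve

end HypIso

theorem corollary2 (D : Set ℍ) (hcompact : IsCompact D) (hdomain : (interior D).Nonempty)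
    (hconvex : HypIso.IsConvex D)
    (γ : ℝ → ℍ) (hγ : HypIso.IsSimpleClosedC1Curve γ) (hboundary : range γ = frontier D) :
    HypIso.curveLength γ ^ 2 ≥ 4 * Real.pi * HypIso.area D + HypIso.area D ^ 2 ∧
      (HypIso.curveLength γ ^ 2 = 4 * Real.pi * HypIso.area D + HypIso.area D ^ 2 ↔
        HypIso.IsDisk D) := by
  obtain ⟨c, t₁, h⟩ := HypIso.exists_normalized hcompact hdomain hγ hboundary
  have hb : range (HypIso.shifted γ c) = frontier D := by rw [HypIso.range_shifted, hboundary]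
  rw [← HypIso.curveLength_shifted hγ c]
  obtain ⟨h1, h2⟩ := HypIso.sq_ge_of_linear (HypIso.shifted γ c 0).im_pos h.lt
    ENNReal.toReal_nonneg (HypIso.linear_inequality hcompact hconvex h hb)
  exact ⟨h1, fun he => HypIso.isDisk_of_linearEq hcompact hdomain hconvex h hb (h2 he),
    HypIso.sq_eq_of_isDisk hcompact hconvex h hb⟩
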